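/- **Setting.** A *polyhedron* is a combinatorial polyhedron, with its vertices removed, that can be realised as a convex ideal polyhedron of positive volume in $\mathbb{H}^3$. An *$n$-gonal pillow* is a 3-cell whose boundary consists of two copies of an $n$-gon identified along corresponding edges, with the vertices removed. A *PPP-cellulation* $\mathcal{P}$ is a cellulation of a 3-manifold by polyhedra and polygonal pillows in which polyhedra are glued along faces to polyhedra or to pillows, and pillows are glued only to polyhedra. $\mathcal{P}$ is triangulated as follows. Each polyhedron is coned from one of its vertices (the tip): faces containing the tip get the cone triangulation from the tip, every other face is triangulated arbitrarily without new vertices, and the tetrahedra are the cones from the tip over the triangles of the faces not containing it. If two polyhedron faces are glued directly, their triangulations agree. In each pillow we insert a layered triangulation: a sequence of diagonal flips taking the triangulation of one side to that of the other, with one tetrahedron layered on for each flip. The result $\mathcal{T}$ is an ideal triangulation of a 3-manifold. We fix realisations of the polyhedra as convex ideal hyperbolic polyhedra and suppose that the following *natural* angles form a semi-angle structure $\alpha$ on $\mathcal{T}$ (angles in $[0,\pi]$, with sum $\pi$ over the three quadrilateral types of each tetrahedron and sum $2\pi$ around each edge): each tetrahedron in a polyhedron has the dihedral angles of the ideal hyperbolic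 tetrahedron spanned by its vertices, and each tetrahedron in a pillow is flat, with angle $\pi$ at the two diagonals of the flipped quadrilateral and $0$ at its four sides. (This holds for a geometric decomposition of a cusped hyperbolic 3-manifold.) A quadrilateral type $q$ is *vertical* if $\alpha(q)=0$, where $\alpha(q)$ is the angle at the two edges disjoint from $q$. A *normal class* is a vector of non-negative integers, one for each normal triangle and quadrilateral type of $\mathcal{T}$, satisfying the normal surface compatibility equations on the faces of $\mathcal{T}$; it is *vertical* if its coordinates at all non-vertical quadrilateral types are zero. *Layered triangulation between two cone triangulations* of an $n$-gon with cone vertices $a$ and $b$: if $a=b$, there are no flips. If $a,b$ are adjacent, label the polygon cyclically $v_1=b,v_2,\dots,v_n=a$ and replace the edge $v_nv_i$ by $v_1v_{i+1}$ for $i=2,\dots,n-2$ in sequence. Otherwise cut the polygon along the edge $ab$ and do this in each of the two resulting polygons (nothing is to be done in a triangle). **Lemma.** Let $S$ be a vertical normal class in $\mathcal{T}$, and let $Q$ be an $n$-gonal pillow of $\mathcal{P}$ whose layered triangulation is the one between two cone triangulations just described. If $Q$ contains vertical quadrilaterals of $S$ (that is, $S$ has a non-zero coordinate at a vertical quadrilateral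 type of some tetrahedron in $Q$), then $n=4$ or $n=6$. If moreover the two cone vertices are adjacent vertices of the $n$-gon, then $n=4$. -/

import Mathlib

open scoped Real RealInnerProductSpace

noncomputable section

/-! ## Ideal triangulations, angle structures, normal classes -/

/-- The normal quadrilateral type of a tetrahedron with vertices `0, 1, 2, 3` that separates
`{i, j}` (for `i ≠ j`) from the other two vertices.  It is the type disjoint from (dual to) the
edge `ij` and the edge opposite to it.  The value on the diagonal is irrelevant. -/
def quadType (i j : Fin 4) : Fin 3 :=
  ![![0, 0, 1, 2], ![0, 0, 2, 1], ![1, 2, 0, 0], ![2, 1, 0, 0]] i j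

/-- An ideal triangulation: finitely many tetrahedra, each with vertices labelled by `Fin 4`, and
face pairings.  The face of `t` opposite to its vertex `i` is glued to the face of `adj t i`
opposite to the vertex `perm t i i`, the vertex `x ≠ i` going to the vertex `perm t i x`.
The triangulated object is the quotient with the vertices removed; it is a 3-manifold precisely
because no edge is identified with itself in the reversed direction. -/
structure IdealTriangulation where
  Tet : Type
  [fintypeTet : Fintype Tet]
  adj : Tet → Fin 4 → Tet
  perm : Tet → Fin 4 → Equiv.Perm (Fin 4)
  adj_adj : ∀ t i, adj (adj t i) (perm t i i) = t
  perm_perm : ∀ t i, perm (adj t i) (perm t i i) = (perm t i)⁻¹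
  /-- No face is glued to itself. -/
  no_fixed_face : ∀ t i, ¬ (adj t i = t ∧ perm t i i = i)
  /-- No edge is identified with its reverse. -/
  edge_ne_reverse : ∀ t i j, i ≠ j →
    ¬ Relation.EqvGen
      (fun e f : Tet × Fin 4 × Fin 4 => ∃ k, k ≠ e.2.1 ∧ k ≠ e.2.2 ∧
        f = (adj e.1 k, perm e.1 k e.2.1, perm e.1 k e.2.2))
      (t, i, j) (t, j, i)

namespace IdealTriangulation

variable (T : IdealTriangulation)

instance : Fintype T.Tet := T.fintypeTet

/-- Two oriented edges `(t, i, j)` of tetrahedra are identified in the triangulation: this is the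
equivalence relation generated by the face pairings. -/
def EdgeEquiv : T.Tet × Fin 4 × Fin 4 → T.Tet × Fin 4 × Fin 4 → Prop :=
  Relation.EqvGen fun e f => ∃ k, k ≠ e.2.1 ∧ k ≠ e.2.2 ∧
    f = (T.adj e.1 k, T.perm e.1 k e.2.1, T.perm e.1 k e.2.2)

open Classical in
/-- Semi-angle structures: `α t q` is the angle at the two edges of `t` dual to the quadrilateral
type `q`.  The angles lie in `[0, π]`, the three angles of each tetrahedron add up to `π`, and the
angles around each edge of the triangulation add up to `2π`.  (As no edge is identified with its
reverse, an edge of a tetrahedron occurs with exactly one orientation in each oriented edge class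
in which it occurs, so the sum counts it once.) -/
structure IsSemiAngleStructure (α : T.Tet → Fin 3 → ℝ) : Prop where
  mem_Icc : ∀ t q, α t q ∈ Set.Icc 0 π
  sum_tet : ∀ t, α t 0 + α t 1 + α t 2 = π
  sum_edge : ∀ t i j, i ≠ j →
    ∑ e : T.Tet × Fin 4 × Fin 4,
      (if T.EdgeEquiv (t, i, j) e then α e.1 (quadType e.2.1 e.2.2) else 0) = 2 * π

/-- A normal class: non-negative integer numbers of normal triangles (one type for each vertex of
each tetrahedron) and of normal quadrilaterals of each type, satisfying the compatibility
equations.  In the face of `t` opposite to `i`, the arcs cutting off the corner `x` come from the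
triangles at `x` and from the quadrilaterals separating `{x, i}` from the two other vertices. -/
structure NormalClass where
  tri : T.Tet → Fin 4 → ℕ
  quad : T.Tet → Fin 3 → ℕ
  compat : ∀ t i x, x ≠ i →
    tri t x + quad t (quadType x i) =
      tri (T.adj t i) (T.perm t i x) +
        quad (T.adj t i) (quadType (T.perm t i x) (T.perm t i i))

/-- A normal class is vertical with respect to `α` if the coordinates of all quadrilateral types
`q` that are not vertical, i.e. for which `α q ≠ 0`, vanish. -/
def NormalClass.IsVertical {T : IdealTriangulation} (S : T.NormalClass)
    (α : T.Tet → Fin 3 → ℝ) : Prop :=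
  ∀ t q, α t q ≠ 0 → S.quad t q = 0

end IdealTriangulation

/-! ## Convex ideal polyhedra -/

/-- `pos` realises a combinatorial map as a convex ideal polyhedron of positive volume in
hyperbolic 3-space, in the projective (Klein) model on the unit ball: ideal points are the points
of the unit sphere and the polyhedron is the convex hull of its ideal vertices.  A dart `d` is an
oriented edge, `next` leads to the next oriented edge around the face on which `d` lies, and `rev`
to the same edge with the reversed orientation, on the neighbouring face.  `pos d` is the position
of the initial vertex of `d`. -/
structure IsIdealRealization {D : Type} (next rev : Equiv.Perm D)
    (pos : D → EuclideanSpace ℝ (Fin 3)) : Prop where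
  norm_eq_one : ∀ d, ‖pos d‖ = 1
  /-- Darts have the same initial vertex iff they are related by turning around that vertex. -/
  pos_eq_iff : ∀ d e, pos d = pos e ↔ (rev * next⁻¹).SameCycle d e
  /-- Positive volume. -/
  span_eq_top : affineSpan ℝ (Set.range pos) = ⊤
  /-- Every face of the map is a face of the convex hull. -/
  face : ∀ d, ∃ (u : EuclideanSpace ℝ (Fin 3)) (c : ℝ), u ≠ 0 ∧
    ∀ e, ⟪u, pos e⟫ ≤ c ∧ (⟪u, pos e⟫ = c ↔ ∃ f, next.SameCycle d f ∧ pos e = pos f)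
  /-- Every edge of the map is an edge of the convex hull. -/
  edge : ∀ d, ∃ (u : EuclideanSpace ℝ (Fin 3)) (c : ℝ), u ≠ 0 ∧
    ∀ e, ⟪u, pos e⟫ ≤ c ∧ (⟪u, pos e⟫ = c ↔ pos e = pos d ∨ pos e = pos (next d))

/-- A polyhedron: a combinatorial cell decomposition of the boundary of a 3-cell, given as a
combinatorial map on a finite set of darts (oriented edges), which can be realised as a convex
ideal hyperbolic polyhedron of positive volume. -/
structure Polyhedron where
  Dart : Type
  [finiteDart : Finite Dart]
  next : Equiv.Perm Dart
  rev : Equiv.Perm Dart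
  rev_rev : ∀ d, rev (rev d) = d
  rev_ne : ∀ d, rev d ≠ d
  nonempty : Nonempty Dart
  connected : ∀ d e, ∃ g ∈ Subgroup.closure {next, rev}, g d = e
  /-- Faces have at least three sides. -/
  next_next_ne : ∀ d, next (next d) ≠ d
  /-- The corners of a face are distinct vertices. -/
  face_simple : ∀ d e, next.SameCycle d e → (rev * next⁻¹).SameCycle d e → d = e
  /-- An oriented edge is determined by its two endpoints. -/
  edge_simple : ∀ d e, (rev * next⁻¹).SameCycle d e →
    (rev * next⁻¹).SameCycle (next d) (next e) → d = e
  realizable : ∃ pos, IsIdealRealization next rev pos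

namespace Polyhedron

/-- The vertices of a polyhedron: classes of darts with the same initial vertex. -/
def Vertex (P : Polyhedron) : Type :=
  Quotient (Equiv.Perm.SameCycle.setoid (P.rev * P.next⁻¹))

/-- The initial vertex of a dart. -/
def vertex (P : Polyhedron) (d : P.Dart) : P.Vertex := Quotient.mk _ d

end Polyhedron

/-- The dihedral angle at the edge `ab` of the ideal hyperbolic tetrahedron with ideal vertices
`a b c d` on the unit sphere: an inversion centred at `a` takes the ball to an upper half space in
which `a` is the point at infinity, the faces through `a` become vertical half planes, and the
angle is the Euclidean angle at the image of `b` of the triangle of the images of `b, c, d`. -/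
def idealDihedralAngle (a b c d : EuclideanSpace ℝ (Fin 3)) : ℝ :=
  EuclideanGeometry.angle (EuclideanGeometry.inversion a 1 c)
    (EuclideanGeometry.inversion a 1 b) (EuclideanGeometry.inversion a 1 d)

/-! ## Triangulations of polygons, diagonal flips, layered triangulations -/

namespace Polygon

variable {n : ℕ}

/-- The chords `ab` and `cd` of a polygon with vertices `ZMod n` (cyclically ordered) cross in
their interiors. -/
def Crosses (a b c d : ZMod n) : Prop :=
  (sbtw a c b ∧ sbtw b d a) ∨ (sbtw a d b ∧ sbtw b c a)

/-- A triangulation of the `n`-gon without additional vertices, given by the graph of its edges: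
a maximal set of pairwise non-crossing chords, including the sides.  Its triangles are the
3-cliques of the graph. -/
structure IsTriangulation (G : SimpleGraph (ZMod n)) : Prop where
  side : ∀ i, G.Adj i (i + 1)
  noncrossing : ∀ a b c d, G.Adj a b → G.Adj c d → ¬ Crosses a b c d
  maximal : ∀ a b, a ≠ b → (∀ c d, G.Adj c d → ¬ Crosses a b c d) → G.Adj a b

/-- The cone triangulation of the polygon with cone vertex `c`. -/
def cone (c : ZMod n) : SimpleGraph (ZMod n) :=
  SimpleGraph.fromRel fun x y => x = c ∨ y = x + 1

/-- `H` arises from `G` by the diagonal flip in the quadrilateral with cyclically ordered corners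
`q 0, q 1, q 2, q 3`, replacing the diagonal from `q 0` to `q 2` with that from `q 1` to `q 3`. -/
structure IsFlip (G : SimpleGraph (ZMod n)) (q : Fin 4 → ZMod n) (H : SimpleGraph (ZMod n)) :
    Prop where
  crosses : Crosses (q 0) (q 2) (q 1) (q 3)
  side : ∀ i, G.Adj (q i) (q (i + 1))
  diagonal : G.Adj (q 0) (q 2)
  eq : H = G.deleteEdges {s(q 0, q 2)} ⊔ SimpleGraph.edge (q 1) (q 3)

/-- A layered triangulation of the `n`-gonal pillow: `len` diagonal flips, the `k`-th of which
takes the layer number `k` to the layer number `k + 1` in the quadrilateral `quad k`.  It has one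
tetrahedron for each flip, with vertices the corners of the quadrilateral; two faces of the
tetrahedron are triangles of the layer below, the other two are triangles of the layer above. -/
structure Layered (n : ℕ) where
  len : ℕ
  layer : Fin (len + 1) → SimpleGraph (ZMod n)
  quad : Fin len → Fin 4 → ZMod n
  isTriangulation : ∀ k, IsTriangulation (layer k)
  isFlip : ∀ k, IsFlip (layer k.castSucc) (quad k) (layer k.succ)

/-- The index of the bottom layer (`false`) and of the top layer (`true`). -/
def Layered.endIndex (L : Layered n) (s : Bool) : Fin (L.len + 1) :=
  if s then Fin.last L.len else 0

/-- The triangulation of the bottom face (`false`) and of the top face (`true`) of the pillow. -/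
def Layered.face (L : Layered n) (s : Bool) : SimpleGraph (ZMod n) := L.layer (L.endIndex s)

/-- The flips from the triangulation coned from `a` to the one coned from `b` in the polygon with
cyclically ordered vertices `v₁ = b, v₂ = b + s, …, v_m = b + (m - 1) s = a` (where `s` is `1` or
`-1`): for `i` from `2` to `m - 2`, replace the edge `v_m v_i` with the edge `v₁ v_{i+1}`.
Here `i = r + 2`. -/
def adjacentFlips (a b s : ZMod n) (m : ℕ) : List (Fin 4 → ZMod n) :=
  (List.range (m - 3)).map fun r => ![a, b, b + s * (r + 1), b + s * (r + 2)]

/-- `L` is the layered triangulation between the cone triangulations with cone vertices `a`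
(bottom) and `b` (top).  If `a = b` there are no flips.  Otherwise, with `b = a + k` and
`1 ≤ k ≤ n - 1`, the edge `ab` cuts the `n`-gon into a `(k + 1)`-gon and an `(n - k + 1)`-gon, in
which the cone vertices are adjacent; in the one and then in the other, the sequence of flips for
adjacent cone vertices is performed.  (If `k = 1` or `n - k = 1`, one of the two is a trivial bigon
and contributes nothing; so do triangles.) -/
structure Layered.IsConeToCone (L : Layered n) (a b : ZMod n) : Prop where
  bottom : L.face false = cone a
  top : L.face true = cone b
  flips : List.ofFn L.quad =
    if a = b then []
    else adjacentFlips a b (-1) ((b - a).val + 1) ++ adjacentFlips a b 1 (n - (b - a).val + 1)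

end Polygon

/-! ## PPP-cellulations -/

/-- A polyhedron and polygonal pillow cellulation.  Polyhedra are glued to polyhedra or to polygonal
pillows, and polygonal pillows only to polyhedra.  So along each joint `j` two faces of polyhedra
meet, either glued directly to each other or glued to the two faces of a polygonal pillow.  The
joint is an `n`-gon, `n = size j`, with vertices labelled cyclically by `ZMod n` (for a pillow,
the two faces of which are identified along corresponding edges, these are its vertices), and its
bottom (`false`) and top (`true`) sides are attached to a face of the polyhedron `side j s`,
matching the vertex `i` with the initial vertex of the dart `att j s i`, in cyclic order with
either orientation.  Every face of every polyhedron occurs exactly once. -/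
structure PPPCellulation where
  Poly : Type
  [finitePoly : Finite Poly]
  poly : Poly → Polyhedron
  Joint : Type
  [finiteJoint : Finite Joint]
  size : Joint → ℕ
  IsPillow : Joint → Prop
  side : Joint → Bool → Poly
  att : ∀ j s, ZMod (size j) → (poly (side j s)).Dart
  att_cyclic : ∀ j s,
    (∀ i, att j s (i + 1) = (poly (side j s)).next (att j s i)) ∨
    (∀ i, att j s (i + 1) = (poly (side j s)).next.symm (att j s i))
  att_bijective : Function.Bijective
    (fun c : (j : Joint) × Bool × ZMod (size j) =>
      (⟨side c.1 c.2.1, att c.1 c.2.1 c.2.2⟩ : (p : Poly) × (poly p).Dart))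

/-- Data of a triangulation of a PPP-cellulation: every polyhedron is coned from a vertex
(the initial vertex of the dart `tip p`) and the bases of the resulting pyramids, that is the faces
not incident to the tip, are triangulated in an arbitrary way; every pillow is given a layered
triangulation between the triangulations of the two faces of polyhedra glued to it.
If two faces are glued directly, their triangulations agree (there are no flips). -/
structure PPPSubdivision (C : PPPCellulation) where
  tip : ∀ p, (C.poly p).Dart
  layering : ∀ j, Polygon.Layered (C.size j)
  direct : ∀ j, ¬ C.IsPillow j → (layering j).len = 0
  cone_of_tip : ∀ j s i,
    (C.poly (C.side j s)).vertex (C.att j s i) = (C.poly (C.side j s)).vertex (tip (C.side j s)) →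
      (layering j).face s = Polygon.cone i

namespace PPPSubdivision

variable {C : PPPCellulation} (K : PPPSubdivision C)

/-- The tetrahedra of the triangulation: in the polyhedra, the cones from the tip over the
triangles `t` of the faces (sides `s` of joints `j`) that do not contain the tip; in the pillows,
one tetrahedron for each diagonal flip. -/
inductive Simplex
  | cone (j : C.Joint) (s : Bool) (t : Finset (ZMod (C.size j)))
      (ht : ((K.layering j).face s).IsNClique 3 t)
      (hs : ∀ i, (C.poly (C.side j s)).vertex (C.att j s i) ≠
        (C.poly (C.side j s)).vertex (K.tip (C.side j s)))
  | layer (j : C.Joint) (k : Fin (K.layering j).len)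

variable {K}

/-- The joint to which a tetrahedron belongs. -/
def Simplex.joint : K.Simplex → C.Joint
  | .cone j _ _ _ _ => j
  | .layer j _ => j

/-- The vertices of a tetrahedron, where `none` is the tip of the polyhedron and `some i` is the
vertex `i` of the joint. -/
def Simplex.verts : (σ : K.Simplex) → Set (Option (ZMod (C.size σ.joint)))
  | .cone j _ t _ _ => insert none (some '' (t : Set (ZMod (C.size j))))
  | .layer j k => Set.range fun i => some ((K.layering j).quad k i)

/-- The tetrahedron belongs to the layered triangulation of the pillow `Q`. -/
def Simplex.InPillow (Q : C.Joint) : K.Simplex → Prop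
  | .cone _ _ _ _ _ => False
  | .layer j _ => j = Q

variable (K)

/-- The vertex of the polyhedron `side j s` that is denoted by an element of
`Option (ZMod (size j))`. -/
def vertexAt (j : C.Joint) (s : Bool) :
    Option (ZMod (C.size j)) → (C.poly (C.side j s)).Vertex
  | none => (C.poly (C.side j s)).vertex (K.tip (C.side j s))
  | some i => (C.poly (C.side j s)).vertex (C.att j s i)

/-- Triangles with a distinguished corner, of three kinds: the face of a tetrahedron opposite to
its vertex `o`, with corner `v`; a triangle `t` of a layer, with corner `i`; and a triangle with
vertex set `t` in a polyhedron (inside it or on its boundary), with corner `v`. -/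
inductive Flag
  | tet (σ : K.Simplex) (o v : Option (ZMod (C.size σ.joint)))
  | layer (j : C.Joint) (k : Fin ((K.layering j).len + 1)) (t : Set (ZMod (C.size j)))
      (i : ZMod (C.size j))
  | poly (p : C.Poly) (t : Set (C.poly p).Vertex) (v : (C.poly p).Vertex)

/-- The elementary coincidences of triangles (with corners) in the triangulation. -/
inductive Ident : K.Flag → K.Flag → Prop
  /-- A face of a tetrahedron in a polyhedron is the triangle in the polyhedron spanned by its
  vertices. -/
  | cone (j s t ht hs) (o v : Option (ZMod (C.size j)))
      (ho : o ∈ (Simplex.cone (K := K) j s t ht hs).verts)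
      (hv : v ∈ (Simplex.cone (K := K) j s t ht hs).verts) (hvo : v ≠ o) :
      Ident (.tet (.cone j s t ht hs) o v)
        (.poly (C.side j s)
          (K.vertexAt j s '' ((Simplex.cone (K := K) j s t ht hs).verts \ {o}))
          (K.vertexAt j s v))
  /-- A triangle of the bottom or top layer is a triangle on the boundary of the polyhedron to
  which the side is attached. -/
  | side (j s) (t : Finset (ZMod (C.size j))) (i : ZMod (C.size j))
      (ht : ((K.layering j).face s).IsNClique 3 t) (hi : i ∈ t) :
      Ident (.layer j ((K.layering j).endIndex s) t i)
        (.poly (C.side j s) ((fun x => K.vertexAt j s (some x)) '' (t : Set _))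
          (K.vertexAt j s (some i)))
  /-- The two faces of a tetrahedron of a pillow that contain the diagonal from `quad 0` to
  `quad 2` are triangles of the layer below. -/
  | below (j k) (o v : Fin 4) (ho : o = 1 ∨ o = 3) (hv : v ≠ o) :
      Ident
        (.tet (.layer j k) (some ((K.layering j).quad k o)) (some ((K.layering j).quad k v)))
        (.layer j k.castSucc ((K.layering j).quad k '' {o}ᶜ) ((K.layering j).quad k v))
  /-- The two faces of a tetrahedron of a pillow that contain the diagonal from `quad 1` to
  `quad 3` are triangles of the layer above. -/
  | above (j k) (o v : Fin 4) (ho : o = 0 ∨ o = 2) (hv : v ≠ o) :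
      Ident
        (.tet (.layer j k) (some ((K.layering j).quad k o)) (some ((K.layering j).quad k v)))
        (.layer j k.succ ((K.layering j).quad k '' {o}ᶜ) ((K.layering j).quad k v))
  /-- A triangle that is not affected by a flip is a triangle of both layers. -/
  | persist (j) (k : Fin (K.layering j).len) (t : Finset (ZMod (C.size j)))
      (i : ZMod (C.size j))
      (ht : ((K.layering j).layer k.castSucc).IsNClique 3 t)
      (ht' : ((K.layering j).layer k.succ).IsNClique 3 t) (hi : i ∈ t) :
      Ident (.layer j k.castSucc t i) (.layer j k.succ t i)

/-- `T` is the triangulation of the PPP-cellulation `C` determined by the subdivision data `K`: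
its tetrahedra are those of `K`, with the vertices labelled by `Fin 4` in some way, and two faces
of tetrahedra are glued, with matching corners, exactly when they are the same triangle. -/
structure Triangulates (T : IdealTriangulation) where
  simplex : T.Tet ≃ K.Simplex
  vert : ∀ t, Fin 4 → Option (ZMod (C.size (simplex t).joint))
  vert_injective : ∀ t, Function.Injective (vert t)
  range_vert : ∀ t, Set.range (vert t) = (simplex t).verts
  glue_iff : ∀ t i x t' i' x', x ≠ i → x' ≠ i' →
    (Relation.EqvGen K.Ident (.tet (simplex t) (vert t i) (vert t x))
        (.tet (simplex t') (vert t' i') (vert t' x')) ↔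
      (t = t' ∧ i = i' ∧ x = x') ∨
        (T.adj t i = t' ∧ T.perm t i i = i' ∧ T.perm t i x = x'))

open Classical in
/-- The natural angle at the edge `wx` of a tetrahedron with vertices `w, x, y, z`, for given
realisations `pos` of the polyhedra as convex ideal hyperbolic polyhedra.  For a tetrahedron in a
polyhedron it is the dihedral angle of the ideal hyperbolic tetrahedron with these vertices.  A
tetrahedron in a pillow is flat: the angle is `π` at the two diagonals of the quadrilateral and `0`
at its four sides. -/
def naturalAngle (pos : ∀ p, (C.poly p).Dart → EuclideanSpace ℝ (Fin 3)) :
    (σ : K.Simplex) → (w x y z : Option (ZMod (C.size σ.joint))) → ℝ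
  | .cone j s _ _ _, w, x, y, z =>
    let P : Option (ZMod (C.size j)) → EuclideanSpace ℝ (Fin 3) := fun v =>
      v.elim (pos (C.side j s) (K.tip (C.side j s))) (fun i => pos (C.side j s) (C.att j s i))
    idealDihedralAngle (P w) (P x) (P y) (P z)
  | .layer j k, w, x, _, _ =>
    let q : Fin 4 → Option (ZMod (C.size j)) := fun i => some ((K.layering j).quad k i)
    if s(w, x) = s(q 0, q 2) ∨ s(w, x) = s(q 1, q 3) then π else 0

variable {K} in
/-- `α` is the natural semi-angle structure for given realisations `pos` of the polyhedra as convex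
ideal hyperbolic polyhedra. -/
structure Triangulates.IsNaturalSemiAngleStructure {T : IdealTriangulation}
    (E : K.Triangulates T) (pos : ∀ p, (C.poly p).Dart → EuclideanSpace ℝ (Fin 3))
    (α : T.Tet → Fin 3 → ℝ) : Prop where
  realization : ∀ p, IsIdealRealization (C.poly p).next (C.poly p).rev (pos p)
  semiAngle : T.IsSemiAngleStructure α
  angle : ∀ t (w x y z : Fin 4), [w, x, y, z].Nodup →
    α t (quadType w x) =
      K.naturalAngle pos (E.simplex t) (E.vert t w) (E.vert t x) (E.vert t y) (E.vert t z)

end PPPSubdivision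

end

namespace Polygon

variable {n : ℕ}

theorem sbtw_iff_val [NeZero n] {a b c : ZMod n} :
    sbtw a b c ↔ a.val < b.val ∧ b.val < c.val ∨ b.val < c.val ∧ c.val < a.val ∨
      c.val < a.val ∧ a.val < b.val := by
  cases n with
  | zero => exact absurd rfl (NeZero.ne 0)
  | succ n => exact Fin.sbtw_iff

theorem val_sub_eq [NeZero n] (x v : ZMod n) :
    v.val ≤ x.val ∧ (x - v).val = x.val - v.val ∨
      x.val < v.val ∧ (x - v).val = n + x.val - v.val := by
  rcases le_or_gt v.val x.val with h | h
  · exact .inl ⟨h, ZMod.val_sub h⟩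
  · refine .inr ⟨h, ?_⟩
    have h1 := ZMod.val_sub h.le
    have h2 : x - v = -(v - x) := by ring
    have h3 : v - x ≠ 0 := by
      intro h0
      rw [sub_eq_zero] at h0
      simp [h0] at h
    have : NeZero (v - x) := ⟨h3⟩
    rw [h2, ZMod.val_neg_of_ne_zero, h1]
    have := ZMod.val_lt v
    omega

theorem sbtw_iff_val_sub [NeZero n] (v : ZMod n) {a b c : ZMod n} :
    sbtw a b c ↔ (a - v).val < (b - v).val ∧ (b - v).val < (c - v).val ∨
      (b - v).val < (c - v).val ∧ (c - v).val < (a - v).val ∨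
      (c - v).val < (a - v).val ∧ (a - v).val < (b - v).val := by
  rw [sbtw_iff_val]
  have ha := ZMod.val_lt a
  have hb := ZMod.val_lt b
  have hc := ZMod.val_lt c
  have hv := ZMod.val_lt v
  rcases val_sub_eq a v with ⟨h1, e1⟩ | ⟨h1, e1⟩ <;>
  rcases val_sub_eq b v with ⟨h2, e2⟩ | ⟨h2, e2⟩ <;>
  rcases val_sub_eq c v with ⟨h3, e3⟩ | ⟨h3, e3⟩ <;>
  rw [e1, e2, e3] <;> omega

theorem val_sub_pos [NeZero n] {v x : ZMod n} (h : x ≠ v) : 0 < (x - v).val := by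
  rw [Nat.pos_iff_ne_zero, Ne, ZMod.val_eq_zero, sub_eq_zero]
  exact h

theorem val_sub_inj [NeZero n] {v x y : ZMod n} (h : (x - v).val = (y - v).val) : x = y := by
  have := ZMod.val_injective n h
  simpa using this

/-- In a triangulated polygon, the triangles at a vertex form a fan: a function on the neighbours
of `v` that takes the same value at `x` and `y` for each triangle `vxy` takes the same value at
the two sides adjacent to `v`. -/
theorem IsTriangulation.fan [NeZero n] {G : SimpleGraph (ZMod n)} (hG : IsTriangulation G)
    (v : ZMod n) (f : ZMod n → ℕ)
    (hf : ∀ x y, G.Adj v x → G.Adj v y → G.Adj x y → f x = f y) : f (v + 1) = f (v - 1) := by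
  classical
  have hlast : G.Adj v (v - 1) := by
    have := hG.side (v - 1)
    rw [sub_add_cancel] at this
    exact this.symm
  have hvl : (v - 1 - v).val = n - 1 := by
    have h1 : v - 1 - v = -1 := by ring
    have h10 : (1 : ZMod n) ≠ 0 := by
      intro h0
      have := hG.side v
      rw [h0, add_zero] at this
      exact this.ne rfl
    have : NeZero (1 : ZMod n) := ⟨h10⟩
    have hn1 : n ≠ 1 := by
      rintro rfl
      exact h10 (Subsingleton.elim _ _)
    have hn0 := NeZero.ne n
    have : Fact (1 < n) := ⟨by omega⟩
    rw [h1, ZMod.val_neg_of_ne_zero, ZMod.val_one]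
  have key : ∀ m, ∀ x, G.Adj v x → n - (x - v).val = m → f x = f (v - 1) := by
    intro m
    induction m using Nat.strong_induction_on with
    | _ m ih =>
      intro x hx hm
      by_cases hxl : x = v - 1
      · rw [hxl]
      let N := Finset.univ.filter fun y => G.Adj v y ∧ (x - v).val < (y - v).val
      have hN : (v - 1) ∈ N := by
        simp only [N, Finset.mem_filter, Finset.mem_univ, true_and]
        refine ⟨hlast, ?_⟩
        have h1 := ZMod.val_lt (x - v)
        have h2 : (x - v).val ≠ (v - 1 - v).val := fun h => hxl (val_sub_inj h)
        omega
      obtain ⟨y, hyN, hy⟩ := N.exists_min_image (fun y => (y - v).val) ⟨_, hN⟩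
      simp only [N, Finset.mem_filter, Finset.mem_univ, true_and] at hyN hy
      have hxy : G.Adj x y := by
        refine hG.maximal x y (by rintro rfl; exact lt_irrefl _ hyN.2) ?_
        have key : ∀ c d, G.Adj c d → (x - v).val < (c - v).val → (c - v).val < (y - v).val →
            ((d - v).val < (x - v).val ∨ (y - v).val < (d - v).val) → False := by
          intro c d hcd h1 h2 h3
          by_cases hd : d = v
          · subst hd
            have := hy c ⟨hcd.symm, h1⟩
            omega
          have hdp := val_sub_pos hd
          have h0 : (v - v).val = 0 := by simp
          rcases h3 with h3 | h3
          · refine hG.noncrossing _ _ _ _ hx hcd ?_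
            right
            rw [sbtw_iff_val_sub v, sbtw_iff_val_sub v, h0]
            omega
          · refine hG.noncrossing _ _ _ _ hyN.1 hcd ?_
            left
            rw [sbtw_iff_val_sub v, sbtw_iff_val_sub v, h0]
            omega
        intro c d hcd hcr
        rcases hcr with ⟨h1, h2⟩ | ⟨h1, h2⟩
        · rw [sbtw_iff_val_sub v] at h1 h2
          exact key c d hcd (by omega) (by omega) (by omega)
        · rw [sbtw_iff_val_sub v] at h1 h2
          exact key d c hcd.symm (by omega) (by omega) (by omega)
      rw [hf x y hx hyN.1 hxy]
      have := ZMod.val_lt (y - v)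
      exact ih _ (by omega) y hyN.1 rfl
  exact key _ _ (hG.side v) rfl

theorem Crosses.ne {a b c d : ZMod n} (h : Crosses a b c d) :
    a ≠ b ∧ a ≠ c ∧ a ≠ d ∧ b ≠ c ∧ b ≠ d ∧ c ≠ d := by
  have aux : ∀ {a b c : ZMod n}, sbtw a b c → a ≠ b ∧ b ≠ c ∧ a ≠ c := by
    intro a b c h
    refine ⟨?_, ?_, ?_⟩ <;> rintro rfl
    · exact sbtw_irrefl_left h
    · exact sbtw_irrefl_right h
    · exact sbtw_irrefl_left_right h
  have hcd : c ≠ d := by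
    rintro rfl
    rcases h with ⟨h1, h2⟩ | ⟨h1, h2⟩
    · exact sbtw_asymm h1 h2
    · exact sbtw_asymm h1 h2
  rcases h with ⟨h1, h2⟩ | ⟨h1, h2⟩
  · obtain ⟨p1, p2, p3⟩ := aux h1
    obtain ⟨q1, q2, q3⟩ := aux h2
    exact ⟨p3, p1, q2.symm, p2.symm, q1, hcd⟩
  · obtain ⟨p1, p2, p3⟩ := aux h1
    obtain ⟨q1, q2, q3⟩ := aux h2
    exact ⟨p3, q2.symm, p1, q1, p2.symm, hcd⟩

theorem IsFlip.injective {G H : SimpleGraph (ZMod n)} {q : Fin 4 → ZMod n} (h : IsFlip G q H) :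
    Function.Injective q := by
  obtain ⟨h1, h2, h3, h4, h5, h6⟩ := h.crosses.ne
  intro i j hij
  fin_cases i <;> fin_cases j <;> simp_all

theorem cone_adj {c x y : ZMod n} :
    (cone c).Adj x y ↔ x ≠ y ∧ (x = c ∨ y = c ∨ y = x + 1 ∨ x = y + 1) := by
  rw [cone, SimpleGraph.fromRel_adj]
  tauto

end Polygon

section Geometry

local notation "E³" => EuclideanSpace ℝ (Fin 3)

/-- A plane is determined by three distinct points of it on the unit sphere. -/
theorem inner_eq_iff_of_three_points {p₁ p₂ p₃ u u' : E³} {c c' : ℝ}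
    (h₁ : ‖p₁‖ = 1) (h₂ : ‖p₂‖ = 1) (h₃ : ‖p₃‖ = 1) (h₁₂ : p₁ ≠ p₂) (h₁₃ : p₁ ≠ p₃)
    (h₂₃ : p₂ ≠ p₃) (hu : u ≠ 0) (hu' : u' ≠ 0)
    (e₁ : ⟪u, p₁⟫ = c) (e₂ : ⟪u, p₂⟫ = c) (e₃ : ⟪u, p₃⟫ = c)
    (e₁' : ⟪u', p₁⟫ = c') (e₂' : ⟪u', p₂⟫ = c') (e₃' : ⟪u', p₃⟫ = c') (x : E³) :
    ⟪u, x⟫ = c ↔ ⟪u', x⟫ = c' := by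
  have hco : EuclideanGeometry.Cospherical ({p₁, p₂, p₃} : Set E³) := by
    refine ⟨0, 1, ?_⟩
    rintro p (rfl | rfl | rfl) <;> simpa
  have hai := hco.affineIndependent_of_ne h₁₂ h₁₃ h₂₃
  rw [affineIndependent_iff_linearIndependent_vsub ℝ _ (0 : Fin 3),
    ← linearIndependent_equiv (finSuccAboveEquiv (0 : Fin 3))] at hai
  set v : Fin 2 → E³ := ((fun i : {x : Fin 3 // x ≠ 0} => (![p₁, p₂, p₃] i -ᵥ ![p₁, p₂, p₃] 0 : E³)) ∘
    finSuccAboveEquiv (0 : Fin 3)) with hv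
  have hv0 : v 0 = p₂ - p₁ := rfl
  have hv1 : v 1 = p₃ - p₁ := rfl
  have hK := finrank_span_eq_card hai
  set K := Submodule.span ℝ (Set.range v)
  have hKo : Module.finrank ℝ Kᗮ = 1 := by
    have := K.finrank_add_finrank_orthogonal
    rw [hK] at this
    simp at this
    omega
  have mem : ∀ w : E³, ⟪w, p₂⟫ = ⟪w, p₁⟫ → ⟪w, p₃⟫ = ⟪w, p₁⟫ → w ∈ Kᗮ := by
    intro w hw2 hw3
    rw [Submodule.mem_orthogonal']
    intro y hy
    induction hy using Submodule.span_induction with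
    | mem y hy =>
      obtain ⟨i, rfl⟩ := hy
      fin_cases i
      · change ⟪w, v 0⟫ = 0
        rw [hv0, inner_sub_right, hw2, sub_self]
      · change ⟪w, v 1⟫ = 0
        rw [hv1, inner_sub_right, hw3, sub_self]
    | zero => simp
    | add y z _ _ hy hz => rw [inner_add_right, hy, hz, add_zero]
    | smul a y _ hy => rw [inner_smul_right, hy, mul_zero]
  have hmu := mem u (e₂.trans e₁.symm) (e₃.trans e₁.symm)
  have hmu' := mem u' (e₂'.trans e₁'.symm) (e₃'.trans e₁'.symm)
  have hne : (⟨u, hmu⟩ : Kᗮ) ≠ 0 := fun h => hu (congrArg Subtype.val h)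
  obtain ⟨r, hr⟩ := (finrank_eq_one_iff_of_nonzero' _ hne).1 hKo ⟨u', hmu'⟩
  have hr' : r • u = u' := congrArg Subtype.val hr
  have hr0 : r ≠ 0 := by
    rintro rfl
    exact hu' (by rw [← hr', zero_smul])
  have hc : c' = r * c := by rw [← e₁', ← hr', real_inner_smul_left, e₁]
  rw [hc, ← hr', real_inner_smul_left, mul_right_inj' hr0]

/-- Three supporting lines of a planar set through a point cannot contain three different
other points. -/
theorem not_three_supporting_edges {u u₁ u₂ u₃ a₁ a₂ a₃ : E³} (hu : u ≠ 0)
    (h₁ : ⟪u, a₁⟫ = 0) (h₂ : ⟪u, a₂⟫ = 0) (h₃ : ⟪u, a₃⟫ = 0)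
    (h₁₁ : ⟪u₁, a₁⟫ = 0) (h₁₂ : ⟪u₁, a₂⟫ < 0) (h₁₃ : ⟪u₁, a₃⟫ < 0)
    (h₂₁ : ⟪u₂, a₁⟫ < 0) (h₂₂ : ⟪u₂, a₂⟫ = 0) (h₂₃ : ⟪u₂, a₃⟫ < 0)
    (h₃₁ : ⟪u₃, a₁⟫ < 0) (h₃₂ : ⟪u₃, a₂⟫ < 0) (h₃₃ : ⟪u₃, a₃⟫ = 0) : False := by
  have hli : ¬ LinearIndependent ℝ ![a₁, a₂, a₃] := by
    intro hli
    have htop := hli.span_eq_top_of_card_eq_finrank (by simp)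
    have hmem : u ∈ Submodule.span ℝ (Set.range ![a₁, a₂, a₃]) := htop ▸ Submodule.mem_top
    have : ∀ y ∈ Submodule.span ℝ (Set.range ![a₁, a₂, a₃]), ⟪u, y⟫ = 0 := by
      intro y hy
      induction hy using Submodule.span_induction with
      | mem y hy =>
        obtain ⟨i, rfl⟩ := hy
        fin_cases i <;> assumption
      | zero => simp
      | add y z _ _ hy hz => rw [inner_add_right, hy, hz, add_zero]
      | smul a y _ hy => rw [inner_smul_right, hy, mul_zero]
    exact hu (inner_self_eq_zero.1 (this u hmem))
  rw [Fintype.not_linearIndependent_iff] at hli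
  obtain ⟨g, hg, i, hi⟩ := hli
  have key : ∀ w : E³, g 0 * ⟪w, a₁⟫ + g 1 * ⟪w, a₂⟫ + g 2 * ⟪w, a₃⟫ = 0 := by
    intro w
    have := congrArg (fun x => ⟪w, x⟫) hg
    simpa [Fin.sum_univ_three, inner_add_right, inner_smul_right] using this
  have k1 := key u₁
  have k2 := key u₂
  have k3 := key u₃
  rw [h₁₁] at k1
  rw [h₂₂] at k2
  rw [h₃₃] at k3
  have opp : ∀ {s t x y : ℝ}, s < 0 → t < 0 → x * s + y * t = 0 → 0 < x → y < 0 := by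
    intro s t x y hs ht h hx
    by_contra hy
    push Not at hy
    nlinarith [mul_pos_of_neg_of_neg (neg_neg_of_pos hx) hs, mul_nonneg hy (neg_nonneg.2 ht.le)]
  have opp' : ∀ {s t x y : ℝ}, s < 0 → t < 0 → x * s + y * t = 0 → x < 0 → 0 < y := by
    intro s t x y hs ht h hx
    have := opp (x := -x) (y := -y) hs ht (by linarith) (by linarith)
    linarith
  have nz : ∀ {s t x y : ℝ}, s < 0 → t < 0 → x * s + y * t = 0 → x = 0 → y = 0 := by
    intro s t x y hs ht h hx
    rw [hx, zero_mul, zero_add] at h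
    exact (mul_eq_zero.1 h).resolve_right ht.ne
  rcases lt_trichotomy (g 0) 0 with h0 | h0 | h0
  · have p1 := opp' (y := g 1) h₃₁ h₃₂ (by linarith) h0
    have p2 := opp' (y := g 2) h₂₁ h₂₃ (by linarith) h0
    have p3 := opp (y := g 2) h₁₂ h₁₃ (by linarith) p1
    linarith
  · have p1 := nz (y := g 1) h₃₁ h₃₂ (by linarith) h0
    have p2 := nz (y := g 2) h₂₁ h₂₃ (by linarith) h0
    fin_cases i <;> exact hi (by assumption)
  · have p1 := opp (y := g 1) h₃₁ h₃₂ (by linarith) h0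
    have p2 := opp (y := g 2) h₂₁ h₂₃ (by linarith) h0
    have p3 := opp' (y := g 2) h₁₂ h₁₃ (by linarith) p1
    linarith

open EuclideanGeometry in
/-- The dihedral angles of a non-degenerate ideal tetrahedron do not vanish. -/
theorem idealDihedralAngle_ne_zero {a b c d : E³} (h : AffineIndependent ℝ ![a, b, c, d]) :
    idealDihedralAngle a b c d ≠ 0 := by
  have hinj := h.injective
  have hca : c ≠ a := fun e => absurd (@hinj 2 0 e) (by decide)
  have hda : d ≠ a := fun e => absurd (@hinj 3 0 e) (by decide)
  intro h0
  rw [idealDihedralAngle, EuclideanGeometry.angle, InnerProductGeometry.angle_eq_zero_iff] at h0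
  obtain ⟨-, r, hr, hrd⟩ := h0
  simp only [inversion, vsub_eq_sub, vadd_eq_add] at hrd
  set B := (1 / dist b a) ^ 2
  set C := (1 / dist c a) ^ 2
  set D' := (1 / dist d a) ^ 2 with hD
  have hD0 : D' ≠ 0 := by
    have : dist d a ≠ 0 := dist_ne_zero.2 hda
    positivity
  rw [affineIndependent_iff] at h
  have := h Finset.univ ![(B - D') + r * (C - B), -B + r * B, - r * C, D'] (by
    simp [Fin.sum_univ_four]; ring) (by
    simp only [Fin.sum_univ_four, Matrix.cons_val]
    have e : D' • (d - a) + a - (B • (b - a) + a) - r • (C • (c - a) + a - (B • (b - a) + a)) = 0 :=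
      sub_eq_zero.2 hrd
    rw [← e]
    module) 3 (Finset.mem_univ _)
  exact hD0 this

end Geometry

namespace Polyhedron

variable {P : Polyhedron} {pos : P.Dart → EuclideanSpace ℝ (Fin 3)}

instance : Finite P.Dart := P.finiteDart

theorem next_prev (d : P.Dart) : P.next (P.next⁻¹ d) = d := P.next.apply_symm_apply d

theorem vertex_eq_iff {d e : P.Dart} :
    P.vertex d = P.vertex e ↔ (P.rev * P.next⁻¹).SameCycle d e := Quotient.eq

theorem pos_eq_iff_vertex (h : IsIdealRealization P.next P.rev pos) {d e : P.Dart} :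
    pos d = pos e ↔ P.vertex d = P.vertex e := by
  rw [h.pos_eq_iff, vertex_eq_iff]

theorem vertex_rev (d : P.Dart) : P.vertex (P.rev d) = P.vertex (P.next d) := by
  rw [eq_comm, vertex_eq_iff]
  refine ⟨1, ?_⟩
  simp

theorem vertex_next_rev (d : P.Dart) : P.vertex (P.next (P.rev d)) = P.vertex d := by
  rw [← vertex_rev, P.rev_rev]

theorem eq_of_vertex_eq {d e : P.Dart} (h : P.vertex d = P.vertex e)
    (h' : P.vertex (P.next d) = P.vertex (P.next e)) : d = e :=
  P.edge_simple d e (vertex_eq_iff.1 h) (vertex_eq_iff.1 h')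

theorem eq_of_face_of_vertex {d e : P.Dart} (h : P.next.SameCycle d e)
    (h' : P.vertex d = P.vertex e) : d = e :=
  P.face_simple d e h (vertex_eq_iff.1 h')

theorem sameCycle_next (d : P.Dart) : P.next.SameCycle d (P.next d) := ⟨1, by simp⟩

theorem sameCycle_prev (d : P.Dart) : P.next.SameCycle d (P.next⁻¹ d) := ⟨-1, by simp⟩

theorem next_ne (d : P.Dart) : P.next d ≠ d := fun h => P.next_next_ne d (by rw [h, h])

theorem vertex_next_ne (d : P.Dart) : P.vertex (P.next d) ≠ P.vertex d := fun h =>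
  next_ne d (eq_of_face_of_vertex (sameCycle_next d) h.symm).symm

theorem vertex_prev_ne (d : P.Dart) : P.vertex (P.next⁻¹ d) ≠ P.vertex d := by
  intro h
  have := vertex_next_ne (P.next⁻¹ d)
  rw [next_prev] at this
  exact this h.symm

theorem vertex_prev_ne_next (d : P.Dart) : P.vertex (P.next⁻¹ d) ≠ P.vertex (P.next d) := by
  intro h
  have h1 := eq_of_face_of_vertex ((sameCycle_prev d).symm.trans (sameCycle_next d)) h
  apply P.next_next_ne (P.next⁻¹ d)
  rw [next_prev, h1]

/-- The vertices of a face that lie on a further supporting plane, containing exactly one more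
vertex besides that of `d`, are adjacent. -/
theorem not_diagonal_supported (h : IsIdealRealization P.next P.rev pos) {d f : P.Dart}
    (hf : ∃ f', P.next.SameCycle d f' ∧ pos f = pos f') (hfd : P.vertex f ≠ P.vertex d)
    (hfn : P.vertex f ≠ P.vertex (P.next d)) (hfp : P.vertex f ≠ P.vertex (P.next⁻¹ d))
    {u₃ : EuclideanSpace ℝ (Fin 3)} {c₃ : ℝ} (hle : ∀ e, ⟪u₃, pos e⟫ ≤ c₃)
    (hd₃ : ⟪u₃, pos d⟫ = c₃) (hf₃ : ⟪u₃, pos f⟫ = c₃)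
    (hn₃ : ⟪u₃, pos (P.next d)⟫ ≠ c₃) (hp₃ : ⟪u₃, pos (P.next⁻¹ d)⟫ ≠ c₃) : False := by
  obtain ⟨u, c, hu, hface⟩ := h.face d
  obtain ⟨u₁, c₁, -, h₁⟩ := h.edge d
  obtain ⟨u₂, c₂, -, h₂⟩ := h.edge (P.next⁻¹ d)
  simp only [next_prev, pos_eq_iff_vertex h] at h₁ h₂
  have fd := (hface d).2.2 ⟨d, .refl _ _, rfl⟩
  have fn := (hface (P.next d)).2.2 ⟨_, sameCycle_next d, rfl⟩
  have fp := (hface (P.next⁻¹ d)).2.2 ⟨_, sameCycle_prev d, rfl⟩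
  have ff := (hface f).2.2 hf
  have lt : ∀ {u' : EuclideanSpace ℝ (Fin 3)} {c' : ℝ} {x y}, ⟪u', pos x⟫ ≤ c' → ⟪u', pos x⟫ ≠ c' →
      ⟪u', pos y⟫ = c' → ⟪u', pos x - pos y⟫ < 0 := by
    intro u' c' x y hx hx' hy
    rw [inner_sub_right, hy]
    exact sub_neg.2 (lt_of_le_of_ne hx hx')
  have eq : ∀ {u' : EuclideanSpace ℝ (Fin 3)} {c' : ℝ} {x y}, ⟪u', pos x⟫ = c' →
      ⟪u', pos y⟫ = c' → ⟪u', pos x - pos y⟫ = 0 := by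
    intro u' c' x y hx hy
    rw [inner_sub_right, hx, hy, sub_self]
  have d1 := (h₁ d).2.2 (.inl rfl)
  have d2 := (h₂ d).2.2 (.inr rfl)
  have vn := vertex_next_ne d
  have vp := vertex_prev_ne d
  have vpn := vertex_prev_ne_next d
  refine not_three_supporting_edges (u := u) (u₁ := u₁) (u₂ := u₂) (u₃ := u₃)
    (a₁ := pos (P.next d) - pos d) (a₂ := pos (P.next⁻¹ d) - pos d) (a₃ := pos f - pos d) hu
    (eq fn fd) (eq fp fd) (eq ff fd) (eq ((h₁ _).2.2 (.inr rfl)) d1)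
    (lt (h₁ _).1 (fun e => ?_) d1) (lt (h₁ _).1 (fun e => ?_) d1)
    (lt (h₂ _).1 (fun e => ?_) d2) (eq ((h₂ _).2.2 (.inl rfl)) d2) (lt (h₂ _).1 (fun e => ?_) d2)
    (lt (hle _) hn₃ hd₃) (lt (hle _) hp₃ hd₃) (eq hf₃ hd₃)
  · exact ((h₁ _).2.1 e).elim vp vpn
  · exact ((h₁ _).2.1 e).elim hfd hfn
  · exact ((h₂ _).2.1 e).elim (fun e => vpn e.symm) vn
  · exact ((h₂ _).2.1 e).elim hfp hfd

/-- A dart at the initial vertex of `d` whose end lies on the face of `d` bounds this face. -/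
theorem eq_or_eq_rev_prev (h : IsIdealRealization P.next P.rev pos) {d d' : P.Dart}
    (hd : P.vertex d' = P.vertex d)
    (hf : ∃ f', P.next.SameCycle d f' ∧ pos (P.next d') = pos f') :
    d' = d ∨ d' = P.rev (P.next⁻¹ d) := by
  by_contra hcon
  push Not at hcon
  obtain ⟨u, c, -, hu⟩ := h.edge d'
  simp only [pos_eq_iff_vertex h] at hu
  have hn : P.vertex (P.next d') ≠ P.vertex (P.next d) := fun e => hcon.1 (eq_of_vertex_eq hd e)
  have hp : P.vertex (P.next d') ≠ P.vertex (P.next⁻¹ d) := fun e => hcon.2 <|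
    eq_of_vertex_eq (by rw [vertex_rev, next_prev, hd])
      (by rw [vertex_next_rev, e])
  refine not_diagonal_supported h hf (fun e => vertex_next_ne d' (e.trans hd.symm)) hn hp
    (fun e => (hu e).1) ((hu d).2.2 (.inl hd.symm)) ((hu _).2.2 (.inr rfl)) (fun e => ?_)
    (fun e => ?_)
  · exact ((hu _).2.1 e).elim (fun e => vertex_next_ne d (e.trans hd)) fun e => hn e.symm
  · exact ((hu _).2.1 e).elim (fun e => vertex_prev_ne d (e.trans hd)) fun e => hp e.symm

theorem sameCycle_rev_of_coplanar (h : IsIdealRealization P.next P.rev pos) {d : P.Dart}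
    (hpl : ∀ f, P.next.SameCycle (P.rev d) f → ∃ f', P.next.SameCycle d f' ∧ pos f = pos f')
    {e : P.Dart} (he : P.next.SameCycle d e) : P.next.SameCycle (P.rev d) (P.rev e) := by
  have he' : (P.next⁻¹).SameCycle d e := Equiv.Perm.sameCycle_inv.2 he
  obtain ⟨k, rfl⟩ := he'.exists_nat_pow_eq
  clear he he'
  induction k with
  | zero => exact .refl _ _
  | succ k ih =>
    rw [pow_succ', Equiv.Perm.mul_apply]
    have hk : P.next.SameCycle d ((P.next⁻¹ ^ k) d) := ⟨-k, by simp⟩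
    set e := (P.next⁻¹ ^ k) d
    have ih' := ih.trans (sameCycle_next (P.rev e))
    obtain ⟨f', hf', hpf⟩ := hpl _ (ih'.trans (sameCycle_next _))
    rcases eq_or_eq_rev_prev h (vertex_next_rev e) ⟨f', hk.symm.trans hf', hpf⟩ with h1 | h1
    · exfalso
      have h2 : P.rev e = P.next⁻¹ e := by rw [Equiv.Perm.eq_inv_iff_eq, h1]
      have h3 := vertex_rev e
      rw [h2] at h3
      exact vertex_prev_ne_next e h3
    · rwa [h1] at ih'

/-- The faces on the two sides of an edge do not lie in one plane. -/
theorem not_coplanar_rev (h : IsIdealRealization P.next P.rev pos) {d : P.Dart}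
    (hpl : ∀ f, P.next.SameCycle (P.rev d) f → ∃ f', P.next.SameCycle d f' ∧ pos f = pos f')
    (hpl' : ∀ f, P.next.SameCycle d f → ∃ f', P.next.SameCycle (P.rev d) f' ∧ pos f = pos f') :
    False := by
  have hY : ∀ g ∈ Subgroup.closure {P.next, P.rev}, ∀ e,
      (P.next.SameCycle d e ∨ P.next.SameCycle (P.rev d) e) ↔
        (P.next.SameCycle d (g e) ∨ P.next.SameCycle (P.rev d) (g e)) := by
    have hrev : ∀ e, (P.next.SameCycle d e ∨ P.next.SameCycle (P.rev d) e) →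
        (P.next.SameCycle d (P.rev e) ∨ P.next.SameCycle (P.rev d) (P.rev e)) := by
      intro e he
      rcases he with he | he
      · exact .inr (sameCycle_rev_of_coplanar h hpl he)
      · left
        have := sameCycle_rev_of_coplanar h (d := P.rev d) (by rwa [P.rev_rev]) he
        rwa [P.rev_rev] at this
    intro g hg
    induction hg using Subgroup.closure_induction with
    | mem g hg =>
      rcases hg with rfl | rfl
      · intro e
        rw [Equiv.Perm.sameCycle_apply_right, Equiv.Perm.sameCycle_apply_right]
      · intro e
        refine ⟨hrev e, fun he => ?_⟩
        have := hrev _ he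
        rwa [P.rev_rev] at this
    | one => intro e; rfl
    | mul x y _ _ hx hy => intro e; rw [hy, hx, Equiv.Perm.mul_apply]
    | inv x _ hx => intro e; rw [hx (x⁻¹ e), Equiv.Perm.eq_inv_iff_eq.1 rfl]
  obtain ⟨u, c, hu, hface⟩ := h.face d
  have hall : ∀ e, ⟪u, pos e⟫ = c := by
    intro e
    obtain ⟨g, hg, rfl⟩ := P.connected d e
    rcases (hY g hg d).1 (.inl (.refl _ _)) with h1 | h1
    · exact (hface _).2.2 ⟨_, h1, rfl⟩
    · exact (hface _).2.2 (hpl _ h1)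
  have hx : ∀ x, ⟪u, x⟫ = c := by
    intro x
    have hx : x ∈ affineSpan ℝ (Set.range pos) := h.span_eq_top ▸ AffineSubspace.mem_top _ _ _
    refine affineSpan_induction (p := fun x => ⟪u, x⟫ = c) hx ?_ ?_
    · rintro _ ⟨e, rfl⟩
      exact hall e
    · intro r x y z h1 h2 h3
      simp only [vsub_eq_sub, vadd_eq_add, inner_add_right, inner_sub_right, inner_smul_right,
        h1, h2, h3]
      ring
  have h0 := hx 0
  rw [inner_zero_right] at h0
  have h1 := hx u
  rw [← h0] at h1
  exact hu (inner_self_eq_zero.1 h1)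

/-- If a vertex of a face is not adjacent in this face to another of its vertices, no other face
contains both of them. -/
theorem not_mem_other_face (h : IsIdealRealization P.next P.rev pos) {d d' f f' : P.Dart}
    (hd : P.vertex d' = P.vertex d) (hne : d' ≠ d) (hf : P.next.SameCycle d f)
    (hfd : P.vertex f ≠ P.vertex d) (hfn : P.vertex f ≠ P.vertex (P.next d))
    (hfp : P.vertex f ≠ P.vertex (P.next⁻¹ d)) (hf' : P.next.SameCycle d' f') :
    P.vertex f' ≠ P.vertex f := by
  intro hff
  obtain ⟨u, c, hu0, hu⟩ := h.face d
  obtain ⟨u', c', hu0', hu'⟩ := h.face d'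
  have pd : pos d' = pos d := (pos_eq_iff_vertex h).2 hd
  have pf : pos f' = pos f := (pos_eq_iff_vertex h).2 hff
  have e1 := (hu d).2.2 ⟨_, .refl _ _, rfl⟩
  have e2 := (hu f).2.2 ⟨_, hf, rfl⟩
  have e1' := (hu' d).2.2 ⟨_, .refl _ _, pd.symm⟩
  have e2' := (hu' f).2.2 ⟨_, hf', pf.symm⟩
  have main : ∀ g, P.next.SameCycle d g → P.vertex g ≠ P.vertex d → P.vertex f ≠ P.vertex g →
      ⟪u', pos g⟫ ≠ c' := by
    intro g hg hgd hgf hug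
    have key : ∀ x, ⟪u, x⟫ = c ↔ ⟪u', x⟫ = c' :=
      inner_eq_iff_of_three_points (h.norm_eq_one d) (h.norm_eq_one f) (h.norm_eq_one g)
        (fun e => hfd ((pos_eq_iff_vertex h).1 e).symm)
        (fun e => hgd ((pos_eq_iff_vertex h).1 e).symm)
        (fun e => hgf ((pos_eq_iff_vertex h).1 e)) hu0 hu0' e1 e2
        ((hu g).2.2 ⟨_, hg, rfl⟩) e1' e2' hug
    have k1 : ∀ x, P.next.SameCycle d' x → ∃ y, P.next.SameCycle d y ∧ pos x = pos y :=
      fun x hx => (hu x).2.1 ((key _).2 ((hu' x).2.2 ⟨x, hx, rfl⟩))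
    have k2 : ∀ x, P.next.SameCycle d x → ∃ y, P.next.SameCycle d' y ∧ pos x = pos y :=
      fun x hx => (hu' x).2.1 ((key _).1 ((hu x).2.2 ⟨x, hx, rfl⟩))
    rcases eq_or_eq_rev_prev h hd (k1 _ (sameCycle_next d')) with h1 | h1
    · exact hne h1
    · have hs := sameCycle_prev d
      refine not_coplanar_rev h (d := P.next⁻¹ d) ?_ ?_
      · rw [← h1]
        intro x hx
        obtain ⟨y, hy, hxy⟩ := k1 x hx
        exact ⟨y, hs.symm.trans hy, hxy⟩
      · rw [← h1]
        intro x hx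
        exact k2 x (hs.trans hx)
  exact not_diagonal_supported h ⟨f, hf, rfl⟩ hfd hfn hfp (fun e => (hu' e).1) e1' e2'
    (main _ (sameCycle_next d) (vertex_next_ne d) hfn)
    (main _ (sameCycle_prev d) (vertex_prev_ne d) hfp)

/-- A vertex of the polyhedron not on a face together with three vertices of the face spans a
non-degenerate ideal tetrahedron. -/
theorem affineIndependent_of_not_mem_face (h : IsIdealRealization P.next P.rev pos) {d : P.Dart}
    {w : Fin 4 → P.Dart} (hw : Function.Injective fun i => P.vertex (w i)) (i : Fin 4)
    (hi : ∀ f, P.next.SameCycle d f → P.vertex f ≠ P.vertex (w i))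
    (hface : ∀ j, j ≠ i → P.next.SameCycle d (w j)) :
    AffineIndependent ℝ fun j => pos (w j) := by
  obtain ⟨u, c, hu0, hu⟩ := h.face d
  refine AffineIndependent.affineIndependent_of_notMem_span (i := i) ?_ ?_
  · rw [← affineIndependent_equiv (finSuccAboveEquiv i)]
    have hco : EuclideanGeometry.Cospherical (Set.range pos) :=
      ⟨0, 1, by rintro _ ⟨e, rfl⟩; simpa using h.norm_eq_one e⟩
    refine hco.affineIndependent ?_ ?_
    · rintro _ ⟨j, rfl⟩
      exact ⟨_, rfl⟩
    · intro j k hjk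
      have := hw ((pos_eq_iff_vertex h).1 hjk)
      exact (finSuccAboveEquiv i).injective (Subtype.ext this)
  · intro hmem
    have : ⟪u, pos (w i)⟫ = c := by
      refine affineSpan_induction (p := fun x => ⟪u, x⟫ = c) hmem ?_ ?_
      · rintro _ ⟨j, hj, rfl⟩
        exact (hu _).2.2 ⟨_, hface j hj, rfl⟩
      · intro r x y z h1 h2 h3
        simp only [vsub_eq_sub, vadd_eq_add, inner_add_right, inner_sub_right, inner_smul_right,
          h1, h2, h3]
        ring
    obtain ⟨f, hf, hpf⟩ := (hu _).2.1 this
    exact hi f hf ((pos_eq_iff_vertex h).1 hpf).symm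

end Polyhedron

theorem Polygon.eq_of_cone_clique {n : ℕ} (hn : 3 ≤ n) {i v y u : ZMod n} (hv : v ≠ i) (hy : y ≠ i)
    (hvy : (cone i).Adj v y) (hvu : (cone i).Adj v u) (hyu : (cone i).Adj y u) : u = i := by
  rw [cone_adj] at hvy hvu hyu
  by_contra hui
  obtain ⟨h0, h⟩ := hvy
  obtain ⟨h1, h'⟩ := hvu
  obtain ⟨h2, h''⟩ := hyu
  simp only [hv, hy, hui, false_or] at h h' h''
  have h30 : (3 : ZMod n) = 0 := by
    rcases h with h | h <;> rcases h' with h' | h' <;> rcases h'' with h'' | h''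
    · exact absurd (h.trans h'.symm) h2
    · exact absurd (h.trans h'.symm) h2
    · linear_combination -h' - h'' - h
    · exact absurd (add_right_cancel (h.symm.trans h'')) h1
    · exact absurd (h.trans h''.symm) h1
    · linear_combination -h' - h'' - h
    · exact absurd (add_right_cancel (h.symm.trans h')) h2
    · exact absurd (add_right_cancel (h.symm.trans h')) h2
  have h5 : ((3 : ℕ) : ZMod n) = 0 := by exact_mod_cast h30
  rw [ZMod.natCast_eq_zero_iff] at h5
  obtain rfl : n = 3 := le_antisymm (Nat.le_of_dvd (by norm_num) h5) hn
  clear h h' h'' h30 h5 hn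
  revert i v y u
  decide

theorem Polygon.eq_or_eq_of_cone_adj {n : ℕ} {i w u : ZMod n} (hw : w ≠ i) (hu : u ≠ i)
    (h : (cone i).Adj w u) : u = w + 1 ∨ u = w - 1 := by
  rw [cone_adj] at h
  rcases h.2 with h | h | h | h
  · exact absurd h hw
  · exact absurd h hu
  · exact .inl h
  · exact .inr (eq_sub_of_add_eq h.symm)

namespace PPPCellulation

variable (C : PPPCellulation)

theorem att_injective (j : C.Joint) (s : Bool) : Function.Injective (C.att j s) := by
  intro x y h
  have := @C.att_bijective.1 ⟨j, s, x⟩ ⟨j, s, y⟩ (by simp [h])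
  simpa using this

theorem size_ne_zero (j : C.Joint) : C.size j ≠ 0 := by
  intro h
  have : Infinite (ZMod (C.size j)) := by
    rw [h]
    exact inferInstanceAs (Infinite ℤ)
  exact not_injective_infinite_finite _ (C.att_injective j true)

instance (j : C.Joint) : NeZero (C.size j) := ⟨C.size_ne_zero j⟩

variable {C}

theorem sameCycle_att_add (j : C.Joint) (s : Bool) (i : ZMod (C.size j)) (m : ℕ) :
    (C.poly (C.side j s)).next.SameCycle (C.att j s i) (C.att j s (i + m)) := by
  induction m with
  | zero =>
    rw [Nat.cast_zero, add_zero]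
  | succ m ih =>
    refine ih.trans ?_
    rw [Nat.cast_succ, ← add_assoc]
    rcases C.att_cyclic j s with h | h
    · rw [h]
      exact Polyhedron.sameCycle_next _
    · rw [h]
      exact Polyhedron.sameCycle_prev _

theorem sameCycle_att (j : C.Joint) (s : Bool) (i i' : ZMod (C.size j)) :
    (C.poly (C.side j s)).next.SameCycle (C.att j s i) (C.att j s i') := by
  have := sameCycle_att_add j s i (i' - i).val
  rwa [ZMod.natCast_zmod_val, add_sub_cancel] at this

theorem next_att (j : C.Joint) (s : Bool) (i : ZMod (C.size j)) :
    (C.poly (C.side j s)).next (C.att j s i) = C.att j s (i + 1) ∧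
        (C.poly (C.side j s)).next⁻¹ (C.att j s i) = C.att j s (i - 1) ∨
      (C.poly (C.side j s)).next (C.att j s i) = C.att j s (i - 1) ∧
        (C.poly (C.side j s)).next⁻¹ (C.att j s i) = C.att j s (i + 1) := by
  rcases C.att_cyclic j s with h | h
  · refine .inl ⟨(h i).symm, ?_⟩
    have := h (i - 1)
    rw [sub_add_cancel] at this
    exact Equiv.Perm.inv_eq_iff_eq.2 this
  · refine .inr ⟨?_, (h i).symm⟩
    have := h (i - 1)
    rw [sub_add_cancel] at this
    rw [this, Equiv.apply_symm_apply]

theorem exists_att_of_sameCycle {j : C.Joint} {s : Bool} {i : ZMod (C.size j)}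
    {f : (C.poly (C.side j s)).Dart} (h : (C.poly (C.side j s)).next.SameCycle (C.att j s i) f) :
    ∃ i', f = C.att j s i' := by
  obtain ⟨m, rfl⟩ := h.exists_nat_pow_eq
  induction m with
  | zero => exact ⟨i, rfl⟩
  | succ m ih =>
    obtain ⟨i', h'⟩ := ih (by exact ⟨m, by simp⟩)
    rw [pow_succ', Equiv.Perm.mul_apply, h']
    rcases next_att j s i' with h | h
    · exact ⟨_, h.1⟩
    · exact ⟨_, h.1⟩

theorem vertex_att_injective (j : C.Joint) (s : Bool) :
    Function.Injective fun i => (C.poly (C.side j s)).vertex (C.att j s i) := fun _ _ h =>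
  C.att_injective j s (Polyhedron.eq_of_face_of_vertex (sameCycle_att j s _ _) h)

theorem three_le_size (j : C.Joint) : 3 ≤ C.size j := by
  by_contra h
  have h1 : (1 : ZMod (C.size j)) + 1 = 0 ∨ (1 : ZMod (C.size j)) = 0 := by
    have h0 := C.size_ne_zero j
    have h2 : C.size j = 1 ∨ C.size j = 2 := by omega
    generalize C.size j = n at h2
    rcases h2 with rfl | rfl
    · exact .inr (Subsingleton.elim _ _)
    · exact .inl (by decide)
  have hs := Polyhedron.vertex_prev_ne_next (C.att j true 0)
  rcases next_att j true 0 with ⟨e1, e2⟩ | ⟨e1, e2⟩ <;> rw [e1, e2] at hs <;> apply hs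
  all_goals
    congr 2
    rcases h1 with h1 | h1
    · first
        | linear_combination -h1
        | linear_combination h1
    · first
        | linear_combination -2 * h1
        | linear_combination 2 * h1

end PPPCellulation

namespace PPPSubdivision.Triangulates

variable {C : PPPCellulation} {K : PPPSubdivision C} {T : IdealTriangulation}
  (E : K.Triangulates T) (S : T.NormalClass)

open Classical in
/-- The number of normal arcs of a normal class that cut off the distinguished corner of a
triangle of the triangulation. -/
noncomputable def arc (F : K.Flag) : ℕ :=
  if h : ∃ p : T.Tet × Fin 4 × Fin 4, p.2.2 ≠ p.2.1 ∧
      Relation.EqvGen K.Ident F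
        (.tet (E.simplex p.1) (E.vert p.1 p.2.1) (E.vert p.1 p.2.2)) then
    S.tri h.choose.1 h.choose.2.2 + S.quad h.choose.1 (quadType h.choose.2.2 h.choose.2.1)
  else 0

variable {S}

theorem arc_congr {F F' : K.Flag} (h : Relation.EqvGen K.Ident F F') : E.arc S F = E.arc S F' := by
  have : Relation.EqvGen K.Ident F = Relation.EqvGen K.Ident F' := funext fun G => propext
    ⟨fun h' => (h.symm).trans _ _ _ h', fun h' => h.trans _ _ _ h'⟩
  unfold arc
  rw [this]

theorem arc_ident {F F' : K.Flag} (h : K.Ident F F') : E.arc S F = E.arc S F' :=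
  E.arc_congr (.rel _ _ h)

theorem arc_tet (t : T.Tet) {i x : Fin 4} (hx : x ≠ i) :
    E.arc S (.tet (E.simplex t) (E.vert t i) (E.vert t x)) =
      S.tri t x + S.quad t (quadType x i) := by
  have h : ∃ p : T.Tet × Fin 4 × Fin 4, p.2.2 ≠ p.2.1 ∧
      Relation.EqvGen K.Ident (.tet (E.simplex t) (E.vert t i) (E.vert t x))
        (.tet (E.simplex p.1) (E.vert p.1 p.2.1) (E.vert p.1 p.2.2)) :=
    ⟨(t, i, x), hx, .refl _⟩
  rw [arc, dif_pos h]
  obtain ⟨h1, h2⟩ := h.choose_spec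
  rcases (E.glue_iff _ _ _ _ _ _ hx h1).1 h2 with ⟨e1, e2, e3⟩ | ⟨e1, e2, e3⟩
  · rw [← e1, ← e2, ← e3]
  · rw [← e1, ← e2, ← e3, ← S.compat t i x hx]

variable {pos : ∀ p, (C.poly p).Dart → EuclideanSpace ℝ (Fin 3)} {α : T.Tet → Fin 3 → ℝ}
variable {E} (hα : E.IsNaturalSemiAngleStructure pos α) (hS : S.IsVertical α)
include hα hS

theorem exists_labels {t : T.Tet} {σ : K.Simplex} (h : E.simplex t = σ) :
    ∃ V : Fin 4 → Option (ZMod (C.size σ.joint)), Function.Injective V ∧ Set.range V = σ.verts ∧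
      (∀ i x, x ≠ i →
        E.arc S (.tet σ (V i) (V x)) = S.tri t x + S.quad t (quadType x i)) ∧
      ∀ w x y z, [w, x, y, z].Nodup →
        K.naturalAngle pos σ (V w) (V x) (V y) (V z) ≠ 0 → S.quad t (quadType w x) = 0 := by
  subst h
  refine ⟨E.vert t, E.vert_injective t, E.range_vert t, fun i x hx => E.arc_tet t hx, ?_⟩
  intro w x y z hn h0
  refine hS t _ ?_
  rwa [hα.angle t w x y z hn]

omit hα hS in
theorem none_mem_verts_cone {j : C.Joint} {s : Bool} {t : Finset (ZMod (C.size j))}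
    {ht : ((K.layering j).face s).IsNClique 3 t}
    {hs : ∀ i, (C.poly (C.side j s)).vertex (C.att j s i) ≠
      (C.poly (C.side j s)).vertex (K.tip (C.side j s))} :
    (none : Option (ZMod (C.size j))) ∈ (Simplex.cone (K := K) j s t ht hs).verts := .inl rfl

omit hα hS in
theorem some_mem_verts_cone {j : C.Joint} {s : Bool} {t : Finset (ZMod (C.size j))}
    {ht : ((K.layering j).face s).IsNClique 3 t}
    {hs : ∀ i, (C.poly (C.side j s)).vertex (C.att j s i) ≠
      (C.poly (C.side j s)).vertex (K.tip (C.side j s))} {a : ZMod (C.size j)} (ha : a ∈ t) :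
    (some a : Option (ZMod (C.size j))) ∈ (Simplex.cone (K := K) j s t ht hs).verts :=
  .inr ⟨a, ha, rfl⟩

/-- Tetrahedra in polyhedra contain no quadrilaterals of a vertical class. -/
theorem arc_cone_eq {j : C.Joint} {s : Bool} {t : Finset (ZMod (C.size j))}
    (ht : ((K.layering j).face s).IsNClique 3 t)
    (hs : ∀ i, (C.poly (C.side j s)).vertex (C.att j s i) ≠
      (C.poly (C.side j s)).vertex (K.tip (C.side j s)))
    {o o' v : Option (ZMod (C.size j))} (ho : o ∈ (Simplex.cone (K := K) j s t ht hs).verts)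
    (ho' : o' ∈ (Simplex.cone (K := K) j s t ht hs).verts)
    (hv : v ∈ (Simplex.cone (K := K) j s t ht hs).verts) (hvo : v ≠ o) (hvo' : v ≠ o') :
    E.arc S (.tet (.cone j s t ht hs) o v) = E.arc S (.tet (.cone j s t ht hs) o' v) := by
  obtain ⟨V, hV, hr, harc, hang⟩ := exists_labels hα hS
    (E.simplex.apply_symm_apply (Simplex.cone (K := K) j s t ht hs))
  rw [← hr] at ho ho' hv
  obtain ⟨i, rfl⟩ := ho
  obtain ⟨i', rfl⟩ := ho'
  obtain ⟨x, rfl⟩ := hv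
  have hnone : none ∈ Set.range V := by
    rw [hr]
    exact Set.mem_insert _ _
  obtain ⟨i₀, hi₀⟩ := hnone
  let dart : Option (ZMod (C.size j)) → (C.poly (C.side j s)).Dart := fun v =>
    v.elim (K.tip (C.side j s)) (C.att j s)
  have hd : ∀ v, v.elim (pos (C.side j s) (K.tip (C.side j s)))
      (fun i => pos (C.side j s) (C.att j s i)) = pos (C.side j s) (dart v) := by
    rintro (_ | v) <;> rfl
  have hsome : ∀ k, k ≠ i₀ → ∃ c, V k = some c := by
    intro k hk
    refine Option.ne_none_iff_exists'.1 fun h => hk (hV (h.trans hi₀.symm))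
  have hai : AffineIndependent ℝ fun k => pos (C.side j s) (dart (V k)) := by
    refine Polyhedron.affineIndependent_of_not_mem_face (hα.realization _) (d := C.att j s 0) ?_ i₀
      ?_ ?_
    · intro k l hkl
      apply hV
      change (C.poly (C.side j s)).vertex (dart (V k)) =
        (C.poly (C.side j s)).vertex (dart (V l)) at hkl
      generalize V k = a at hkl ⊢
      generalize V l = b at hkl ⊢
      rcases a with _ | a <;> rcases b with _ | b
      · rfl
      · exact absurd hkl.symm (hs b)
      · exact absurd hkl (hs a)
      · exact congrArg some (C.vertex_att_injective j s hkl)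
    · intro f hf
      obtain ⟨i', rfl⟩ := C.exists_att_of_sameCycle hf
      rw [hi₀]
      exact hs i'
    · intro k hk
      obtain ⟨c, hc⟩ := hsome k hk
      rw [hc]
      exact C.sameCycle_att j s 0 c
  have hq : ∀ w x, w ≠ x → S.quad (E.simplex.symm (.cone j s t ht hs)) (quadType w x) = 0 := by
    intro w x hwx
    obtain ⟨y, z, hn⟩ : ∃ y z, [w, x, y, z].Nodup := by
      revert w x
      decide
    refine hang w x y z hn ?_
    simp only [naturalAngle]
    erw [hd, hd, hd, hd]
    have hinj : Function.Injective ![w, x, y, z] := by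
      rw [← List.nodup_ofFn]
      simpa using hn
    have := hai.comp_embedding ⟨_, hinj⟩
    refine idealDihedralAngle_ne_zero ?_
    convert this using 1
    funext k
    fin_cases k <;> rfl
  have hxi : x ≠ i := fun e => hvo (e ▸ rfl)
  have hxi' : x ≠ i' := fun e => hvo' (e ▸ rfl)
  erw [harc i x hxi, harc i' x hxi', hq _ _ hxi, hq _ _ hxi']

omit hα hS in
theorem arc_cone_face {j : C.Joint} {s : Bool} {t : Finset (ZMod (C.size j))}
    (ht : ((K.layering j).face s).IsNClique 3 t)
    (hs : ∀ i, (C.poly (C.side j s)).vertex (C.att j s i) ≠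
      (C.poly (C.side j s)).vertex (K.tip (C.side j s)))
    {c x y : ZMod (C.size j)} (hxc : x ≠ c) (hxy : x ≠ y)
    (hm : ∀ a, a ∈ t ↔ a = c ∨ a = x ∨ a = y)
    {v : Option (ZMod (C.size j))} (hv : v = none ∨ v = some c) :
    E.arc S (.tet (.cone j s t ht hs) (some x) v) =
      E.arc S (.poly (C.side j s) {K.vertexAt j s none, K.vertexAt j s (some c),
        K.vertexAt j s (some y)} (K.vertexAt j s v)) := by
  have h1 : (insert none (some '' (t : Set (ZMod (C.size j)))) : Set (Option (ZMod (C.size j)))) \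
      {some x} = {none, some c, some y} := by
    ext a
    rcases a with _ | a
    · simp
    · simp only [Set.mem_sdiff, Set.mem_insert_iff, reduceCtorEq, Set.mem_image,
        Finset.mem_coe, hm, Option.some.injEq, exists_eq_right, Set.mem_singleton_iff, false_or]
      constructor
      · rintro ⟨h | h | h, h'⟩
        · exact .inl h
        · exact absurd h h'
        · exact .inr h
      · rintro (h | h)
        · exact ⟨.inl h, h ▸ hxc.symm⟩
        · exact ⟨.inr (.inr h), h ▸ hxy.symm⟩
  have h2 := Ident.cone (K := K) j s t ht hs (some x) v
    (some_mem_verts_cone ((hm x).2 (.inr (.inl rfl))))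
    (by rcases hv with rfl | rfl
        · exact none_mem_verts_cone
        · exact some_mem_verts_cone ((hm c).2 (.inl rfl)))
    (by rcases hv with rfl | rfl <;> simp [hxc.symm])
  refine (E.arc_ident h2).trans ?_
  have h3 := congrArg (fun A => K.vertexAt j s '' A) h1
  simp only [Set.image_insert_eq, Set.image_singleton] at h3
  exact congrArg (fun A => E.arc S (.poly (C.side j s) A (K.vertexAt j s v))) h3

/-- Across the corner of a face that does not contain the tip, the numbers of arcs at the tip and
at the corner agree. -/
theorem arc_poly_next_eq_prev (p : C.Poly) (e : (C.poly p).Dart)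
    (he : ∀ f, (C.poly p).next.SameCycle e f →
      (C.poly p).vertex f ≠ (C.poly p).vertex (K.tip p))
    {v : (C.poly p).Vertex} (hv : v = (C.poly p).vertex (K.tip p) ∨ v = (C.poly p).vertex e) :
    E.arc S (.poly p {(C.poly p).vertex (K.tip p), (C.poly p).vertex e,
        (C.poly p).vertex ((C.poly p).next e)} v) =
      E.arc S (.poly p {(C.poly p).vertex (K.tip p), (C.poly p).vertex e,
        (C.poly p).vertex ((C.poly p).next⁻¹ e)} v) := by
  obtain ⟨⟨j, s, c⟩, h⟩ := C.att_bijective.2 ⟨p, e⟩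
  cases h
  have hs : ∀ i, (C.poly (C.side j s)).vertex (C.att j s i) ≠
      (C.poly (C.side j s)).vertex (K.tip (C.side j s)) := fun i => he _ (C.sameCycle_att j s c i)
  obtain ⟨v', hv', rfl⟩ : ∃ v', (v' = none ∨ v' = some c) ∧ v = K.vertexAt j s v' := by
    rcases hv with rfl | rfl
    · exact ⟨none, .inl rfl, rfl⟩
    · exact ⟨some c, .inr rfl, rfl⟩
  have key := ((K.layering j).isTriangulation ((K.layering j).endIndex s)).fan c
    (fun x => E.arc S (.poly (C.side j s) {K.vertexAt j s none, K.vertexAt j s (some c),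
        K.vertexAt j s (some x)} (K.vertexAt j s v'))) (by
      intro x y hx hy hxy
      have ht : ((K.layering j).face s).IsNClique 3 {c, x, y} :=
        SimpleGraph.is3Clique_triple_iff.2 ⟨hx, hy, hxy⟩
      have h1 := arc_cone_face (E := E) (S := S) ht hs hx.ne' hxy.ne (by simp) hv'
      have h2 := arc_cone_face (E := E) (S := S) ht hs hy.ne' hxy.ne' (by intro a; simp; tauto) hv'
      rw [← h1, ← h2]
      refine (arc_cone_eq hα hS ht hs (o := some x) (o' := some y) (v := v')
        (some_mem_verts_cone (by simp)) (some_mem_verts_cone (by simp)) ?_ ?_ ?_).symm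
      · rcases hv' with rfl | rfl
        · exact none_mem_verts_cone
        · exact some_mem_verts_cone (by simp)
      · rcases hv' with rfl | rfl
        · exact Option.some_ne_none _ |>.symm
        · exact fun h => hx.ne (Option.some.inj h)
      · rcases hv' with rfl | rfl
        · exact Option.some_ne_none _ |>.symm
        · exact fun h => hy.ne (Option.some.inj h))
  rcases C.next_att j s c with ⟨e1, e2⟩ | ⟨e1, e2⟩
  · simp only [e1, e2]
    exact key
  · simp only [e1, e2]
    exact key.symm

/-- Turning around a vertex of a face containing the tip, not adjacent to the tip. -/
theorem arc_poly_next_eq_prev_of_tip (p : C.Poly) (e f : (C.poly p).Dart)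
    (hf : (C.poly p).next.SameCycle e f)
    (hft : (C.poly p).vertex f = (C.poly p).vertex (K.tip p))
    (hfe : f ≠ e) (hfn : f ≠ (C.poly p).next e) (hfp : f ≠ (C.poly p).next⁻¹ e)
    {v : (C.poly p).Vertex} (hv : v = (C.poly p).vertex (K.tip p) ∨ v = (C.poly p).vertex e) :
    E.arc S (.poly p {(C.poly p).vertex (K.tip p), (C.poly p).vertex e,
        (C.poly p).vertex ((C.poly p).next e)} v) =
      E.arc S (.poly p {(C.poly p).vertex (K.tip p), (C.poly p).vertex e,
        (C.poly p).vertex ((C.poly p).next⁻¹ e)} v) := by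
  obtain ⟨ρ, hρ⟩ : ∃ ρ, ρ = (C.poly p).rev * (C.poly p).next⁻¹ := ⟨_, rfl⟩
  have hρv : ∀ k : ℕ, (C.poly p).vertex ((ρ ^ k) e) = (C.poly p).vertex e := fun k =>
    (Polyhedron.vertex_eq_iff.2 ⟨k, by simp [hρ]⟩).symm
  have hρn : ∀ d, (C.poly p).vertex ((C.poly p).next (ρ d)) = (C.poly p).vertex ((C.poly p).next⁻¹ d) := fun d => by
    rw [hρ]
    exact Polyhedron.vertex_next_rev _
  have step : ∀ k : ℕ, (ρ ^ k) e ≠ e →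
      E.arc S (.poly p {(C.poly p).vertex (K.tip p), (C.poly p).vertex e, (C.poly p).vertex ((C.poly p).next ((ρ ^ k) e))} v) =
      E.arc S (.poly p {(C.poly p).vertex (K.tip p), (C.poly p).vertex e, (C.poly p).vertex ((C.poly p).next ((ρ ^ (k + 1)) e))} v) := by
    intro k hk
    have := arc_poly_next_eq_prev (E := E) hα hS p ((ρ ^ k) e) (fun g hg => by
      rw [← hft]
      refine Polyhedron.not_mem_other_face (hα.realization p) (hρv k) hk hf ?_ ?_ ?_ hg
      · exact fun h => hfe (Polyhedron.eq_of_face_of_vertex hf h.symm).symm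
      · exact fun h => hfn (Polyhedron.eq_of_face_of_vertex
          (hf.symm.trans (Polyhedron.sameCycle_next e)) h)
      · exact fun h => hfp (Polyhedron.eq_of_face_of_vertex
          (hf.symm.trans (Polyhedron.sameCycle_prev e)) h)) (v := v) (by rwa [hρv k])
    rw [hρv k] at this
    rw [this, pow_succ', Equiv.Perm.mul_apply, hρn]
  have hex : ∃ m : ℕ, 0 < m ∧ (ρ ^ m) e = e := ⟨orderOf ρ, orderOf_pos ρ, by simp [pow_orderOf_eq_one]⟩
  classical
  obtain ⟨hm0, hm⟩ := Nat.find_spec hex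
  have hmin : ∀ k, 0 < k → k < Nat.find hex → (ρ ^ k) e ≠ e := fun k h0 hk h =>
    Nat.find_min hex hk ⟨h0, h⟩
  set m := Nat.find hex
  have chain : ∀ k, 0 < k → k ≤ m →
      E.arc S (.poly p {(C.poly p).vertex (K.tip p), (C.poly p).vertex e, (C.poly p).vertex ((C.poly p).next ((ρ ^ 1) e))} v) =
      E.arc S (.poly p {(C.poly p).vertex (K.tip p), (C.poly p).vertex e, (C.poly p).vertex ((C.poly p).next ((ρ ^ k) e))} v) := by
    intro k h0
    induction k, h0 using Nat.le_induction with
    | base => intro _; rfl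
    | succ k hk ih =>
      intro hkm
      rw [ih (by omega)]
      exact step k (hmin k hk (by omega))
  have := chain m hm0 le_rfl
  rw [hm, pow_one, hρn] at this
  exact this.symm

omit hα hS in
theorem arc_layer_endIndex {j : C.Joint} {s : Bool} {v x y : ZMod (C.size j)}
    (hvx : ((K.layering j).face s).Adj v x) (hvy : ((K.layering j).face s).Adj v y)
    (hxy : ((K.layering j).face s).Adj x y) :
    E.arc S (.layer j ((K.layering j).endIndex s) {v, x, y} v) =
      E.arc S (.poly (C.side j s) {K.vertexAt j s (some v), K.vertexAt j s (some x),
        K.vertexAt j s (some y)} (K.vertexAt j s (some v))) := by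
  have ht : ((K.layering j).face s).IsNClique 3 {v, x, y} :=
    SimpleGraph.is3Clique_triple_iff.2 ⟨hvx, hvy, hxy⟩
  have := E.arc_ident (S := S) (Ident.side (K := K) j s {v, x, y} v ht (by simp))
  rw [Finset.coe_insert, Finset.coe_pair, Set.image_insert_eq, Set.image_pair] at this
  exact this

/-- In two adjacent triangles on a face of a polyhedron, the numbers of normal arcs at a common
corner agree. -/
theorem arc_layer_endIndex_eq {j : C.Joint} {s : Bool} {v x y z : ZMod (C.size j)}
    (hvx : ((K.layering j).face s).Adj v x) (hvy : ((K.layering j).face s).Adj v y)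
    (hxy : ((K.layering j).face s).Adj x y) (hvz : ((K.layering j).face s).Adj v z)
    (hyz : ((K.layering j).face s).Adj y z) :
    E.arc S (.layer j ((K.layering j).endIndex s) {v, x, y} v) =
      E.arc S (.layer j ((K.layering j).endIndex s) {v, y, z} v) := by
  by_cases hxz : x = z
  · rw [hxz, Set.pair_comm z y]
  by_cases htip : ∃ i, (C.poly (C.side j s)).vertex (C.att j s i) =
      (C.poly (C.side j s)).vertex (K.tip (C.side j s))
  · rw [arc_layer_endIndex hvx hvy hxy, arc_layer_endIndex hvy hvz hyz]
    obtain ⟨i, hi⟩ := htip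
    have hcone := K.cone_of_tip j s i hi
    rw [hcone] at hvx hvy hxy hvz hyz
    have main : ∀ w, w ≠ i → (v = i ∧ y = w ∨ v = w ∧ y = i) → x ≠ i → z ≠ i →
        (x = w + 1 ∧ z = w - 1 ∨ x = w - 1 ∧ z = w + 1) →
        E.arc S (.poly (C.side j s) {K.vertexAt j s (some v), K.vertexAt j s (some x),
          K.vertexAt j s (some y)} (K.vertexAt j s (some v))) =
        E.arc S (.poly (C.side j s) {K.vertexAt j s (some v), K.vertexAt j s (some y),
          K.vertexAt j s (some z)} (K.vertexAt j s (some v))) := by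
      intro w hwi hvy hx hz hxz
      have hi1 : i ≠ w + 1 := by 
        rcases hxz with ⟨h, h'⟩ | ⟨h, h'⟩
        · exact h ▸ hx.symm
        · exact h' ▸ hz.symm
      have hi2 : i ≠ w - 1 := by 
        rcases hxz with ⟨h, h'⟩ | ⟨h, h'⟩
        · exact h' ▸ hz.symm
        · exact h ▸ hx.symm
      have inj := C.att_injective j s
      have key := arc_poly_next_eq_prev_of_tip (E := E) hα hS (C.side j s) (C.att j s w)
        (C.att j s i) (C.sameCycle_att j s w i) hi (fun h => hwi (inj h).symm)
        (by rcases C.next_att j s w with ⟨e1, e2⟩ | ⟨e1, e2⟩ <;> rw [e1] <;> exact inj.ne ‹_›)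
        (by rcases C.next_att j s w with ⟨e1, e2⟩ | ⟨e1, e2⟩ <;> rw [e2] <;> exact inj.ne ‹_›)
        (v := K.vertexAt j s (some v))
        (by rcases hvy with ⟨h, -⟩ | ⟨h, -⟩ <;> rw [h]
            · exact .inl hi
            · exact .inr rfl)
      have key' : E.arc S (.poly (C.side j s) {K.vertexAt j s (some i), K.vertexAt j s (some w),
          K.vertexAt j s (some x)} (K.vertexAt j s (some v))) =
        E.arc S (.poly (C.side j s) {K.vertexAt j s (some i), K.vertexAt j s (some w),
          K.vertexAt j s (some z)} (K.vertexAt j s (some v))) := by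
        rw [← hi] at key
        rcases C.next_att j s w with ⟨e1, e2⟩ | ⟨e1, e2⟩ <;> rw [e1, e2] at key <;>
          rcases hxz with ⟨h, h'⟩ | ⟨h, h'⟩ <;> rw [h, h']
        · exact key
        · exact key.symm
        · exact key.symm
        · exact key
      rcases hvy with ⟨h, h'⟩ | ⟨h, h'⟩
      · rw [h, h', Set.pair_comm (K.vertexAt j s (some x))]
        rw [h] at key'
        exact key'
      · rw [h, h', Set.insert_comm (K.vertexAt j s (some w)) (K.vertexAt j s (some i)),
          Set.pair_comm (K.vertexAt j s (some x)), Set.insert_comm (K.vertexAt j s (some w))]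
        rw [h] at key'
        exact key'
    by_cases hv : v = i
    · have hy : y ≠ i := fun h => hvy.ne (hv.trans h.symm)
      have hx : x ≠ i := fun h => hvx.ne (hv.trans h.symm)
      have hz : z ≠ i := fun h => hvz.ne (hv.trans h.symm)
      have px := Polygon.eq_or_eq_of_cone_adj hy hx hxy.symm
      have pz := Polygon.eq_or_eq_of_cone_adj hy hz hyz
      refine main y hy (.inl ⟨hv, rfl⟩) hx hz ?_
      rcases px with px | px <;> rcases pz with pz | pz
      · exact absurd (px.trans pz.symm) hxz
      · exact .inl ⟨px, pz⟩
      · exact .inr ⟨px, pz⟩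
      · exact absurd (px.trans pz.symm) hxz
    · by_cases hy : y = i
      · have hx : x ≠ i := fun h => hxy.ne (h.trans hy.symm)
        have hz : z ≠ i := fun h => hyz.ne (hy.trans h.symm)
        have px := Polygon.eq_or_eq_of_cone_adj hv hx hvx
        have pz := Polygon.eq_or_eq_of_cone_adj hv hz hvz
        refine main v hv (.inr ⟨rfl, hy⟩) hx hz ?_
        rcases px with px | px <;> rcases pz with pz | pz
        · exact absurd (px.trans pz.symm) hxz
        · exact .inl ⟨px, pz⟩
        · exact .inr ⟨px, pz⟩
        · exact absurd (px.trans pz.symm) hxz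
      · exfalso
        have hx := Polygon.eq_of_cone_clique (C.three_le_size j) hv hy hvy hvx hxy.symm
        have hz := Polygon.eq_of_cone_clique (C.three_le_size j) hv hy hvy hvz hyz
        exact hxz (hx.trans hz.symm)
  · push Not at htip
    have main : ∀ x, ∀ t : Finset (ZMod (C.size j)), (K.layering j).face s |>.IsNClique 3 t →
        (∀ a, a ∈ t ↔ a = v ∨ a = x ∨ a = y) → x ≠ v → x ≠ y → v ≠ y →
        E.arc S (.layer j ((K.layering j).endIndex s) t v) =
          E.arc S (.poly (C.side j s) {K.vertexAt j s none, K.vertexAt j s (some v),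
            K.vertexAt j s (some y)} (K.vertexAt j s (some v))) := by
      intro x t ht hm hxv hxy hvy
      have hv : v ∈ t := (hm v).2 (.inl rfl)
      have hx : x ∈ t := (hm x).2 (.inr (.inl rfl))
      have hset : (insert none (some '' (t : Set (ZMod (C.size j)))) :
          Set (Option (ZMod (C.size j)))) \ {none} = some '' (t : Set (ZMod (C.size j))) := by
        ext a
        rcases a with _ | a <;> simp
      have h1 := E.arc_ident (S := S) (Ident.side (K := K) j s t v ht hv)
      have h2 := E.arc_ident (S := S) (Ident.cone (K := K) j s t ht htip none (some v)
        none_mem_verts_cone (some_mem_verts_cone hv) (by simp))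
      have h3 := congrArg (fun A => K.vertexAt j s '' A) hset
      simp only [Set.image_image] at h3
      have h4 := h2.trans
        (congrArg (fun A => E.arc S (.poly (C.side j s) A (K.vertexAt j s (some v)))) h3)
      refine h1.trans (h4.symm.trans ?_)
      refine (arc_cone_eq hα hS ht htip (o' := some x) none_mem_verts_cone
        (some_mem_verts_cone hx) (some_mem_verts_cone hv) (by simp)
        (fun h => hxv (Option.some.inj h).symm)).trans ?_
      exact arc_cone_face ht htip hxv hxy hm (.inr rfl)
    have h1 := main x {v, x, y} (SimpleGraph.is3Clique_triple_iff.2 ⟨hvx, hvy, hxy⟩) (by simp)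
      hvx.ne' hxy.ne hvy.ne
    have h2 := main z {v, y, z} (SimpleGraph.is3Clique_triple_iff.2 ⟨hvy, hvz, hyz⟩)
      (by intro a; simp; tauto) hvz.ne' hyz.ne' hvy.ne
    simp only [Finset.coe_insert, Finset.coe_singleton] at h1 h2
    rw [h1, h2]

end PPPSubdivision.Triangulates

theorem SimpleGraph.isNClique_three_mono {V : Type*} {G H : SimpleGraph V} {t : Finset V}
    (ht : G.IsNClique 3 t) (h : ∀ x ∈ t, ∀ y ∈ t, G.Adj x y → H.Adj x y) : H.IsNClique 3 t :=
  ⟨fun x hx y hy hxy => h x hx y hy (ht.isClique hx hy hxy), ht.card_eq⟩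

namespace Polygon

variable {n : ℕ} {G H : SimpleGraph (ZMod n)} {q : Fin 4 → ZMod n}

theorem IsFlip.adj_of_adj (h : IsFlip G q H) {x y : ZMod n} (hxy : G.Adj x y)
    (hne : s(x, y) ≠ s(q 0, q 2)) : H.Adj x y := by
  rw [h.eq, SimpleGraph.sup_adj, SimpleGraph.deleteEdges_adj]
  exact .inl ⟨hxy, hne⟩

theorem IsFlip.adj_of_adj' (h : IsFlip G q H) {x y : ZMod n} (hxy : H.Adj x y)
    (hne : s(x, y) ≠ s(q 1, q 3)) : G.Adj x y := by
  rw [h.eq, SimpleGraph.sup_adj, SimpleGraph.deleteEdges_adj, SimpleGraph.edge_adj] at hxy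
  rcases hxy with hxy | ⟨hxy | hxy, -⟩
  · exact hxy.1
  · exact absurd (by rw [hxy.1, hxy.2]) hne
  · exact absurd (by rw [hxy.1, hxy.2, Sym2.eq_swap]) hne

theorem IsFlip.adj_one_three (h : IsFlip G q H) : H.Adj (q 1) (q 3) := by
  rw [h.eq, SimpleGraph.sup_adj, SimpleGraph.edge_adj]
  exact .inr ⟨.inl ⟨rfl, rfl⟩, h.injective.ne (by decide)⟩

theorem IsFlip.side' (h : IsFlip G q H) (i : Fin 4) : H.Adj (q i) (q (i + 1)) := by
  refine h.adj_of_adj (h.side i) fun e => ?_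
  have := h.injective
  rw [Sym2.eq_iff] at e
  rcases e with ⟨e1, e2⟩ | ⟨e1, e2⟩
  · exact absurd (this e2) (by rw [this e1]; decide)
  · exact absurd (this e2) (by rw [this e1]; decide)

theorem IsFlip.isNClique_of_isNClique (h : IsFlip G q H) {t : Finset (ZMod n)}
    (ht : G.IsNClique 3 t) (hq : ¬ (q 0 ∈ t ∧ q 2 ∈ t)) : H.IsNClique 3 t := by
  refine SimpleGraph.isNClique_three_mono ht fun x hx y hy hxy => h.adj_of_adj hxy fun e => hq ?_
  rw [Sym2.eq_iff] at e
  rcases e with ⟨rfl, rfl⟩ | ⟨rfl, rfl⟩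
  · exact ⟨hx, hy⟩
  · exact ⟨hy, hx⟩

theorem IsFlip.isNClique_of_isNClique' (h : IsFlip G q H) {t : Finset (ZMod n)}
    (ht : H.IsNClique 3 t) (hq : ¬ (q 1 ∈ t ∧ q 3 ∈ t)) : G.IsNClique 3 t := by
  refine SimpleGraph.isNClique_three_mono ht fun x hx y hy hxy => h.adj_of_adj' hxy fun e => hq ?_
  rw [Sym2.eq_iff] at e
  rcases e with ⟨rfl, rfl⟩ | ⟨rfl, rfl⟩
  · exact ⟨hx, hy⟩
  · exact ⟨hy, hx⟩

end Polygon

theorem quadType_swap (w x : Fin 4) : quadType w x = quadType x w := by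
  revert w x
  decide

theorem quadType_opposite {w x y z : Fin 4} (h : [w, x, y, z].Nodup) :
    quadType y z = quadType w x := by
  revert w x y z
  decide

theorem eq_quadType {w x y z : Fin 4} (h : [w, x, y, z].Nodup) (i : Fin 3) :
    i = quadType w x ∨ i = quadType w y ∨ i = quadType w z := by
  revert w x y z i
  decide

/-- The linear algebra of a sequence of flips between two cone triangulations with adjacent cone
vertices: only a single flip can contain quadrilaterals. -/
theorem flip_sequence_dichotomy {P R A B : ℕ → ℕ} {M : ℕ} (hP : ∀ r < M, P r = P (r + 1) + B r)
    (hR : ∀ r < M, R (r + 1) = R r + B r) (hX : ∀ r < M, P 0 = P (r + 1) + A r)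
    (hY : ∀ r, r + 1 < M → R r + A r = R (r + 1) + A (r + 1)) :
    ((∀ r < M, A r = 0 ∧ B r = 0) ∧ P M = P 0) ∨ (M = 1 ∧ P M ≠ P 0) := by
  rcases Nat.lt_or_ge M 2 with hM | hM
  · interval_cases M
    · left
      simp
    · have h1 := hP 0 (by omega)
      have h2 := hX 0 (by omega)
      simp only [zero_add] at h1 h2
      by_cases hB : B 0 = 0
      · refine .inl ⟨fun r hr => ?_, by omega⟩
        obtain rfl : r = 0 := by omega
        omega
      · exact .inr ⟨rfl, by omega⟩
  · left
    have key : ∀ r, r + 1 < M → B r = 0 ∧ B (r + 1) = 0 ∧ A (r + 1) = A r := by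
      intro r hr
      have h1 := hP (r + 1) hr
      have h2 := hR r (by omega)
      have h3 := hX r (by omega)
      have h4 := hX (r + 1) hr
      have h5 := hY r hr
      omega
    have hB : ∀ r < M, B r = 0 := by
      intro r hr
      rcases Nat.lt_or_ge (r + 1) M with h | h
      · exact (key r h).1
      · obtain ⟨r, rfl⟩ : ∃ k, r = k + 1 := ⟨r - 1, by omega⟩
        exact (key r hr).2.1
    have hA : ∀ r < M, A r = 0 := by
      intro r
      induction r with
      | zero =>
        intro h
        have h1 := hP 0 h
        have h2 := hX 0 h
        have h3 := hB 0 h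
        omega
      | succ r ih =>
        intro h
        rw [(key r h).2.2, ih (by omega)]
    refine ⟨fun r hr => ⟨hA r hr, hB r hr⟩, ?_⟩
    have h1 := hX (M - 1) (by omega)
    rw [hA _ (by omega), Nat.sub_add_cancel (by omega)] at h1
    omega

namespace PPPSubdivision.Triangulates

variable {C : PPPCellulation} {K : PPPSubdivision C} {T : IdealTriangulation}
  {E : K.Triangulates T} {S : T.NormalClass}
variable {pos : ∀ p, (C.poly p).Dart → EuclideanSpace ℝ (Fin 3)} {α : T.Tet → Fin 3 → ℝ}

/-- A triangle not affected by the flips above a layer persists. -/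
theorem arc_layer_up {Q : C.Joint} {t : Finset (ZMod (C.size Q))}
    {k l : Fin ((K.layering Q).len + 1)} (hkl : k ≤ l)
    (ht : ((K.layering Q).layer k).IsNClique 3 t)
    (hm : ∀ m : Fin (K.layering Q).len, k ≤ m.castSucc → m.castSucc < l →
      ¬ ((K.layering Q).quad m 0 ∈ t ∧ (K.layering Q).quad m 2 ∈ t)) :
    ((K.layering Q).layer l).IsNClique 3 t ∧
      ∀ i ∈ t, E.arc S (.layer Q k t i) = E.arc S (.layer Q l t i) := by
  induction l using Fin.induction with
  | zero =>
    obtain rfl : k = 0 := le_antisymm hkl (Fin.zero_le _)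
    exact ⟨ht, fun _ _ => rfl⟩
  | succ m ih =>
    rcases hkl.eq_or_lt with rfl | hlt
    · exact ⟨ht, fun _ _ => rfl⟩
    have hkm : k ≤ m.castSucc := Fin.le_castSucc_iff.2 hlt
    obtain ⟨h1, h2⟩ := ih hkm fun m' h h' => hm m' h (h'.trans Fin.castSucc_lt_succ)
    have h3 := ((K.layering Q).isFlip m).isNClique_of_isNClique h1
      (hm m hkm Fin.castSucc_lt_succ)
    exact ⟨h3, fun i hi => (h2 i hi).trans (E.arc_ident (.persist Q m t i h1 h3 hi))⟩

/-- A triangle not created by the flips below a layer persists downwards. -/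
theorem arc_layer_down {Q : C.Joint} {t : Finset (ZMod (C.size Q))}
    {l : Fin ((K.layering Q).len + 1)}
    (ht : ((K.layering Q).layer l).IsNClique 3 t)
    (hm : ∀ m : Fin (K.layering Q).len, m.castSucc < l →
      ¬ ((K.layering Q).quad m 1 ∈ t ∧ (K.layering Q).quad m 3 ∈ t)) :
    ((K.layering Q).layer 0).IsNClique 3 t ∧
      ∀ i ∈ t, E.arc S (.layer Q 0 t i) = E.arc S (.layer Q l t i) := by
  induction l using Fin.induction with
  | zero => exact ⟨ht, fun _ _ => rfl⟩
  | succ m ih =>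
    have h3 := ((K.layering Q).isFlip m).isNClique_of_isNClique' ht (hm m Fin.castSucc_lt_succ)
    obtain ⟨h1, h2⟩ := ih h3 fun m' h' => hm m' (h'.trans Fin.castSucc_lt_succ)
    exact ⟨h1, fun i hi => (h2 i hi).trans (E.arc_ident (.persist Q m t i h3 ht hi))⟩

section

variable (hα : E.IsNaturalSemiAngleStructure pos α) (hS : S.IsVertical α)
include hα hS

/-- The numbers of arcs at the corners `q 0` and `q 1` of the faces of a tetrahedron of a pillow,
where `A` and `B` are the numbers of vertical quadrilaterals of the two types. -/
theorem exists_arc_flip {Q : C.Joint} (k : Fin (K.layering Q).len) {t : T.Tet}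
    (ht : E.simplex t = .layer Q k) :
    ∃ A B : ℕ, (A = 0 ∧ B = 0 → ∀ i, S.quad t i = 0) ∧
      let q := (K.layering Q).quad k
      E.arc S (.layer Q k.castSucc {q 0, q 1, q 2} (q 0)) =
        E.arc S (.layer Q k.succ {q 0, q 1, q 3} (q 0)) + B ∧
      E.arc S (.layer Q k.succ {q 0, q 1, q 3} (q 1)) =
        E.arc S (.layer Q k.castSucc {q 0, q 1, q 2} (q 1)) + B ∧
      E.arc S (.layer Q k.castSucc {q 0, q 2, q 3} (q 0)) =
        E.arc S (.layer Q k.succ {q 0, q 1, q 3} (q 0)) + A ∧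
      E.arc S (.layer Q k.succ {q 1, q 2, q 3} (q 1)) =
        E.arc S (.layer Q k.castSucc {q 0, q 1, q 2} (q 1)) + A := by
  obtain ⟨V, hV, hr, harc, hang⟩ := exists_labels hα hS ht
  have hq := ((K.layering Q).isFlip k).injective
  have hex : ∀ i, ∃ l, V l = some ((K.layering Q).quad k i) := by
    intro i
    have : (some ((K.layering Q).quad k i) : Option (ZMod (C.size Q))) ∈
        (Simplex.layer (K := K) Q k).verts := ⟨i, rfl⟩
    rw [← hr] at this
    exact this
  choose f hf using hex
  have hfi : Function.Injective f := by
    intro i j hij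
    have := (hf i).symm.trans ((congrArg V hij).trans (hf j))
    exact hq (Option.some.inj this)
  have hnd : [f 0, f 1, f 2, f 3].Nodup := by
    have := List.nodup_ofFn.2 hfi
    simpa using this
  have hnd' : [f 0, f 3, f 1, f 2].Nodup := by
    have := List.nodup_ofFn.2 (hfi.comp (g := f) (f := ![0, 3, 1, 2]) (by decide))
    simpa using this
  have hnd'' : [f 0, f 2, f 1, f 3].Nodup := by
    have := List.nodup_ofFn.2 (hfi.comp (g := f) (f := ![0, 2, 1, 3]) (by decide))
    simpa using this
  have h02 : S.quad t (quadType (f 0) (f 2)) = 0 := by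
    refine hang _ _ (f 1) (f 3) hnd'' ?_
    rw [hf 0, hf 2]
    simp only [naturalAngle]
    rw [if_pos (.inl rfl)]
    exact Real.pi_ne_zero
  have h13 : S.quad t (quadType (f 1) (f 3)) = 0 := by
    rw [quadType_opposite hnd'', h02]
  have arcs : ∀ o v : Fin 4, v ≠ o → E.arc S
      (.tet (.layer Q k) (some ((K.layering Q).quad k o)) (some ((K.layering Q).quad k v))) =
      S.tri t (f v) + S.quad t (quadType (f v) (f o)) := by
    intro o v hvo
    have := harc (f o) (f v) (hfi.ne hvo)
    rw [hf o, hf v] at this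
    exact this
  have img : ∀ o x y z : Fin 4, ({o}ᶜ : Set (Fin 4)) = {x, y, z} →
      (K.layering Q).quad k '' {o}ᶜ = {(K.layering Q).quad k x, (K.layering Q).quad k y,
        (K.layering Q).quad k z} := by
    intro o x y z h
    rw [h, Set.image_insert_eq, Set.image_pair]
  have i0 := img 0 1 2 3 (by ext x; fin_cases x <;> simp)
  have i1 := img 1 0 2 3 (by ext x; fin_cases x <;> simp)
  have i2 := img 2 0 1 3 (by ext x; fin_cases x <;> simp)
  have i3 := img 3 0 1 2 (by ext x; fin_cases x <;> simp)
  have below : ∀ o v : Fin 4, (o = 1 ∨ o = 3) → v ≠ o →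
      E.arc S (.layer Q k.castSucc ((K.layering Q).quad k '' {o}ᶜ) ((K.layering Q).quad k v)) =
        S.tri t (f v) + S.quad t (quadType (f v) (f o)) := fun o v ho hv =>
    (E.arc_ident (.below Q k o v ho hv)).symm.trans (arcs o v hv)
  have above : ∀ o v : Fin 4, (o = 0 ∨ o = 2) → v ≠ o →
      E.arc S (.layer Q k.succ ((K.layering Q).quad k '' {o}ᶜ) ((K.layering Q).quad k v)) =
        S.tri t (f v) + S.quad t (quadType (f v) (f o)) := fun o v ho hv =>
    (E.arc_ident (.above Q k o v ho hv)).symm.trans (arcs o v hv)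
  have b30 := below 3 0 (by decide) (by decide)
  have b31 := below 3 1 (by decide) (by decide)
  have b10 := below 1 0 (by decide) (by decide)
  have a20 := above 2 0 (by decide) (by decide)
  have a21 := above 2 1 (by decide) (by decide)
  have a01 := above 0 1 (by decide) (by decide)
  rw [i3] at b30 b31
  rw [i1] at b10
  rw [i2] at a20 a21
  rw [i0] at a01
  refine ⟨S.quad t (quadType (f 0) (f 1)), S.quad t (quadType (f 0) (f 3)), ?_, ?_⟩
  · rintro ⟨hA, hB⟩ i
    rcases eq_quadType hnd i with rfl | rfl | rfl
    · exact hA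
    · exact h02
    · exact hB
  · intro q
    rw [b30, b31, b10, a20, a21, a01, h02, h13, quadType_swap (f 1) (f 0),
      quadType_opposite hnd']
    exact ⟨rfl, rfl, rfl, rfl⟩

/-- The flips from the cone triangulation with cone vertex `a` to that with cone vertex `b` in one
of the two polygons into which `ab` cuts the face of a pillow: if the polygon contains
quadrilaterals, there is only one flip, and the number of arcs at `a` in the triangle adjacent to
`ab` changes. -/
theorem flips_dichotomy {Q : C.Joint} {a b : ZMod (C.size Q)} (o M : ℕ)
    (hoM : o + M ≤ (K.layering Q).len) (v : ℕ → ZMod (C.size Q))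
    (hbot : ((K.layering Q).layer 0).IsNClique 3 {a, b, v 1})
    (hq : ∀ r < M, ∀ h : o + r < (K.layering Q).len,
      (K.layering Q).quad ⟨o + r, h⟩ = ![a, b, v (r + 1), v (r + 2)])
    (hother : ∀ m : Fin (K.layering Q).len, (m : ℕ) < o ∨ o + M ≤ m →
      (K.layering Q).quad m 0 = a ∧ (K.layering Q).quad m 1 = b ∧
      ∀ i, 1 ≤ i → i ≤ M + 1 → (K.layering Q).quad m 2 ≠ v i) :
    ((K.layering Q).layer (Fin.last _)).IsNClique 3 {a, b, v (M + 1)} ∧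
    ((∀ r < M, ∀ h : o + r < (K.layering Q).len, ∀ t, E.simplex t = .layer Q ⟨o + r, h⟩ →
        ∀ i, S.quad t i = 0) ∧
        E.arc S (.layer Q (Fin.last _) {a, b, v (M + 1)} a) =
          E.arc S (.layer Q 0 {a, b, v 1} a) ∨
      M = 1 ∧ E.arc S (.layer Q (Fin.last _) {a, b, v (M + 1)} a) ≠
        E.arc S (.layer Q 0 {a, b, v 1} a)) := by
  have h01 : ∀ m, (K.layering Q).quad m 0 = a ∧ (K.layering Q).quad m 1 = b := by
    intro m
    by_cases hm : (m : ℕ) < o ∨ o + M ≤ m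
    · exact ⟨(hother m hm).1, (hother m hm).2.1⟩
    · push Not at hm
      obtain ⟨r, hr⟩ := Nat.exists_eq_add_of_le hm.1
      have hm' : m = ⟨o + r, hr ▸ m.2⟩ := Fin.ext hr
      rw [hm', hq r (by omega)]
      exact ⟨rfl, rfl⟩
  have hinj := fun m => ((K.layering Q).isFlip m).injective
  have hother' : ∀ m : Fin (K.layering Q).len, (m : ℕ) < o ∨ o + M ≤ m → ∀ i, 1 ≤ i → i ≤ M + 1 →
      ¬ ((K.layering Q).quad m 0 ∈ ({a, b, v i} : Finset _) ∧ (K.layering Q).quad m 2 ∈ ({a, b, v i} : Finset _)) := by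
    rintro m hm i h1 h2 ⟨-, h⟩
    simp only [Finset.mem_insert, Finset.mem_singleton] at h
    rcases h with h | h | h
    · exact absurd (hinj m (h.trans (h01 m).1.symm)) (by decide)
    · exact absurd (hinj m (h.trans (h01 m).2.symm)) (by decide)
    · exact (hother m hm).2.2 i h1 h2 h
  let lay : ℕ → Fin ((K.layering Q).len + 1) := fun m => Fin.ofNat ((K.layering Q).len + 1) m
  have hlay : ∀ m, m ≤ (K.layering Q).len → (lay m : ℕ) = m := fun m hm => Nat.mod_eq_of_lt (by omega)
  have hcast : ∀ m (h : m < (K.layering Q).len), (⟨m, h⟩ : Fin (K.layering Q).len).castSucc = lay m := fun m h =>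
    Fin.ext (hlay m h.le).symm
  have hsucc : ∀ m (h : m < (K.layering Q).len), (⟨m, h⟩ : Fin (K.layering Q).len).succ = lay (m + 1) := fun m h =>
    Fin.ext (hlay (m + 1) h).symm
  have hA : ∀ r, ∃ A B : ℕ, r < M → (A = 0 ∧ B = 0 → ∀ h : o + r < (K.layering Q).len, ∀ t,
        E.simplex t = .layer Q ⟨o + r, h⟩ → ∀ i, S.quad t i = 0) ∧
      E.arc S (.layer Q (lay (o + r)) {a, b, v (r + 1)} a) =
        E.arc S (.layer Q (lay (o + r + 1)) {a, b, v (r + 2)} a) + B ∧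
      E.arc S (.layer Q (lay (o + r + 1)) {a, b, v (r + 2)} b) =
        E.arc S (.layer Q (lay (o + r)) {a, b, v (r + 1)} b) + B ∧
      E.arc S (.layer Q (lay (o + r)) {a, v (r + 1), v (r + 2)} a) =
        E.arc S (.layer Q (lay (o + r + 1)) {a, b, v (r + 2)} a) + A ∧
      E.arc S (.layer Q (lay (o + r + 1)) {b, v (r + 1), v (r + 2)} b) =
        E.arc S (.layer Q (lay (o + r)) {a, b, v (r + 1)} b) + A := by
    intro r
    by_cases hr : r < M
    swap
    · exact ⟨0, 0, fun h => absurd h hr⟩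
    have h : o + r < (K.layering Q).len := by omega
    obtain ⟨A, B, h0, h1⟩ := exists_arc_flip hα hS ⟨o + r, h⟩
      (E.simplex.apply_symm_apply (.layer Q ⟨o + r, h⟩))
    rw [hq r hr h, hcast _ h, hsucc _ h] at h1
    refine ⟨A, B, fun _ => ⟨fun hAB h t ht i => ?_, h1⟩⟩
    have : t = E.simplex.symm (.layer Q ⟨o + r, h⟩) := by rw [← ht, E.simplex.symm_apply_apply]
    rw [this]
    exact h0 hAB i
  choose A B hAB using hA
  have inj_of : ∀ r < M, Function.Injective ![a, b, v (r + 1), v (r + 2)] := by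
    intro r hr
    have := hinj ⟨o + r, by omega⟩
    rwa [hq r hr (by omega)] at this
  have low : ∀ r < M, ((K.layering Q).layer 0).IsNClique 3 {a, v (r + 1), v (r + 2)} ∧
      E.arc S (.layer Q 0 {a, v (r + 1), v (r + 2)} a) =
        E.arc S (.layer Q (lay (o + r)) {a, v (r + 1), v (r + 2)} a) := by
    intro r hr
    have hlt : o + r < (K.layering Q).len := by omega
    have hf := (K.layering Q).isFlip ⟨o + r, hlt⟩
    rw [hq r hr hlt, hcast _ hlt, hsucc _ hlt] at hf
    have hcl : ((K.layering Q).layer (lay (o + r))).IsNClique 3 {a, v (r + 1), v (r + 2)} :=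
      SimpleGraph.is3Clique_triple_iff.2 ⟨hf.diagonal, (hf.side 3).symm, hf.side 2⟩
    obtain ⟨h1, h2⟩ := arc_layer_down (E := E) (S := S) hcl (by
      rintro m - ⟨h, -⟩
      rw [(h01 m).2] at h
      simp only [Finset.mem_insert, Finset.mem_singleton] at h
      rcases h with h | h | h
      · exact absurd (@inj_of r hr 1 0 h) (by decide)
      · exact absurd (@inj_of r hr 1 2 h) (by decide)
      · exact absurd (@inj_of r hr 1 3 h) (by decide))
    refine ⟨h1, ?_⟩
    have := h2 a (by simp)
    simpa using this
  have high : ∀ r < M, ((K.layering Q).layer (Fin.last _)).IsNClique 3 {b, v (r + 1), v (r + 2)} ∧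
      E.arc S (.layer Q (lay (o + r + 1)) {b, v (r + 1), v (r + 2)} b) =
        E.arc S (.layer Q (Fin.last _) {b, v (r + 1), v (r + 2)} b) := by
    intro r hr
    have hlt : o + r < (K.layering Q).len := by omega
    have hf := (K.layering Q).isFlip ⟨o + r, hlt⟩
    rw [hq r hr hlt, hcast _ hlt, hsucc _ hlt] at hf
    have hcl : ((K.layering Q).layer (lay (o + r + 1))).IsNClique 3 {b, v (r + 1), v (r + 2)} :=
      SimpleGraph.is3Clique_triple_iff.2 ⟨hf.side' 1, hf.adj_one_three, hf.side' 2⟩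
    obtain ⟨h1, h2⟩ := arc_layer_up (E := E) (S := S) (Fin.le_last _) hcl (by
      rintro m - - ⟨h, -⟩
      rw [(h01 m).1] at h
      simp only [Finset.mem_insert, Finset.mem_singleton] at h
      rcases h with h | h | h
      · exact absurd (@inj_of r hr 0 1 h) (by decide)
      · exact absurd (@inj_of r hr 0 2 h) (by decide)
      · exact absurd (@inj_of r hr 0 3 h) (by decide))
    refine ⟨h1, ?_⟩
    have := h2 b (by simp)
    simpa using this
  obtain ⟨hcl0, harc0⟩ := arc_layer_up (E := E) (S := S) (Fin.zero_le (lay o)) hbot (by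
    intro m _ hm
    rw [Fin.lt_def, hlay o (by omega)] at hm
    exact hother' m (.inl hm) 1 le_rfl (by omega))
  have hclM : ((K.layering Q).layer (lay (o + M))).IsNClique 3 {a, b, v (M + 1)} := by
    rcases Nat.eq_zero_or_pos M with rfl | hM
    · exact hcl0
    · obtain ⟨r, rfl⟩ : ∃ r, M = r + 1 := ⟨M - 1, by omega⟩
      have hlt : o + r < (K.layering Q).len := by omega
      have hf := (K.layering Q).isFlip ⟨o + r, hlt⟩
      rw [hq r (by omega) hlt, hcast _ hlt, hsucc _ hlt] at hf
      exact SimpleGraph.is3Clique_triple_iff.2 ⟨hf.side' 0, (hf.side' 3).symm, hf.adj_one_three⟩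
  obtain ⟨hcl1, harc1⟩ := arc_layer_up (E := E) (S := S) (Fin.le_last (lay (o + M))) hclM (by
    intro m hm _
    rw [Fin.le_def, hlay _ hoM] at hm
    exact hother' m (.inr hm) (M + 1) (by omega) le_rfl)
  refine ⟨hcl1, ?_⟩
  have e0 := harc0 a (by simp)
  have e1 := harc1 a (by simp)
  simp only [Finset.coe_insert, Finset.coe_singleton] at e0 e1
  rw [e0, ← e1]
  have hX : ∀ r < M, E.arc S (.layer Q 0 {a, v (r + 1), v (r + 2)} a) =
      E.arc S (.layer Q 0 {a, b, v 1} a) := by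
    intro r
    obtain ⟨hab, hav, hbv⟩ := SimpleGraph.is3Clique_triple_iff.1 hbot
    induction r with
    | zero =>
      intro hr
      obtain ⟨-, c1, c2⟩ := SimpleGraph.is3Clique_triple_iff.1 (low 0 hr).1
      exact (arc_layer_endIndex_eq (s := false) hα hS hab hav hbv c1 c2).symm
    | succ r ih =>
      intro hr
      obtain ⟨c1, c2, c3⟩ := SimpleGraph.is3Clique_triple_iff.1 (low r (by omega)).1
      obtain ⟨-, c4, c5⟩ := SimpleGraph.is3Clique_triple_iff.1 (low (r + 1) hr).1
      rw [← ih (by omega)]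
      exact (arc_layer_endIndex_eq (s := false) hα hS c1 c2 c3 c4 c5).symm
  have hY : ∀ r, r + 1 < M → E.arc S (.layer Q (Fin.last _) {b, v (r + 1), v (r + 2)} b) =
      E.arc S (.layer Q (Fin.last _) {b, v (r + 2), v (r + 3)} b) := by
    intro r hr
    obtain ⟨c1, c2, c3⟩ := SimpleGraph.is3Clique_triple_iff.1 (high r (by omega)).1
    obtain ⟨-, c4, c5⟩ := SimpleGraph.is3Clique_triple_iff.1 (high (r + 1) hr).1
    exact arc_layer_endIndex_eq (s := true) hα hS c1 c2 c3 c4 c5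
  have main := flip_sequence_dichotomy
    (P := fun r => E.arc S (.layer Q (lay (o + r)) {a, b, v (r + 1)} a))
    (R := fun r => E.arc S (.layer Q (lay (o + r)) {a, b, v (r + 1)} b)) (A := A) (B := B) (M := M)
    (fun r hr => (hAB r hr).2.1) (fun r hr => (hAB r hr).2.2.1)
    (fun r hr => by
      refine Eq.trans ?_ (hAB r hr).2.2.2.1
      rw [← (low r hr).2, hX r hr, e0]
      rfl)
    (fun r hr => by
      refine (hAB r (by omega)).2.2.2.2.symm.trans (Eq.trans ?_ (hAB (r + 1) hr).2.2.2.2)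
      rw [(high r (by omega)).2, hY r hr, ← (high (r + 1) hr).2])
  rcases main with ⟨h1, h2⟩ | h
  · exact .inl ⟨fun r hr h t ht => (hAB r hr).1 (h1 r hr) h t ht, h2⟩
  · exact .inr h

end

end PPPSubdivision.Triangulates

namespace Polygon

variable {n : ℕ}

/-- The flips of a layered triangulation between two cone triangulations. -/
theorem Layered.IsConeToCone.quad_eq {L : Layered n} {a b : ZMod n} (h : L.IsConeToCone a b)
    (hab : a ≠ b) :
    L.len = ((b - a).val - 2) + (n - (b - a).val - 2) ∧
    (∀ r < (b - a).val - 2, ∀ hr : r < L.len, L.quad ⟨r, hr⟩ =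
      ![a, b, b - ((r + 1 : ℕ) : ZMod n), b - ((r + 2 : ℕ) : ZMod n)]) ∧
    (∀ r < n - (b - a).val - 2, ∀ hr : ((b - a).val - 2) + r < L.len,
      L.quad ⟨((b - a).val - 2) + r, hr⟩ =
        ![a, b, b + ((r + 1 : ℕ) : ZMod n), b + ((r + 2 : ℕ) : ZMod n)]) := by
  have hf := h.flips
  rw [if_neg hab] at hf
  simp only [adjacentFlips] at hf
  have e1 : (b - a).val + 1 - 3 = (b - a).val - 2 := by omega
  have e2 : n - (b - a).val + 1 - 3 = n - (b - a).val - 2 := by omega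
  have e3 : ∀ N : ℕ, (do let i ← List.range N; pure (i : ZMod n)) =
      (List.range N).map fun i : ℕ => (i : ZMod n) := fun N => (List.map_eq_flatMap ..).symm
  rw [e1, e2, e3, e3, List.map_map, List.map_map] at hf
  refine ⟨by simpa using congrArg List.length hf, fun r hr h' => ?_, fun r hr h' => ?_⟩
  · have := congrArg (fun l => l[r]?) hf
    rw [List.getElem?_append_left (by simpa using hr)] at this
    simp only [List.getElem?_ofFn, h', dite_true, List.getElem?_map, List.getElem?_range hr,
      Option.map_some, Option.some.injEq] at this
    rw [this]
    simp only [Function.comp_apply]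
    push_cast
    congr 3 <;> ring_nf
  · have := congrArg (fun l => l[(b - a).val - 2 + r]?) hf
    rw [List.getElem?_append_right (by simp)] at this
    simp only [List.getElem?_ofFn, h', dite_true, List.length_map, List.length_range,
      Nat.add_sub_cancel_left, List.getElem?_map, List.getElem?_range hr,
      Option.map_some, Option.some.injEq] at this
    rw [this]
    simp only [Function.comp_apply]
    push_cast
    congr 3 <;> ring_nf

theorem sub_natCast_ne_add_natCast (b : ZMod n) {i j : ℕ} (h0 : 0 < i + j) (hn : i + j < n) :
    b - (i : ZMod n) ≠ b + (j : ZMod n) := by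
  intro h
  have h1 : ((i + j : ℕ) : ZMod n) = 0 := by
    push_cast
    linear_combination -h
  rw [ZMod.natCast_eq_zero_iff] at h1
  exact absurd (Nat.le_of_dvd h0 h1) (by omega)

end Polygon

theorem mainTheorem5 (C : PPPCellulation) (K : PPPSubdivision C) (T : IdealTriangulation)
    (E : K.Triangulates T)
    (pos : ∀ p, (C.poly p).Dart → EuclideanSpace ℝ (Fin 3)) (α : T.Tet → Fin 3 → ℝ)
    (hα : E.IsNaturalSemiAngleStructure pos α)
    (S : T.NormalClass) (hS : S.IsVertical α)
    (Q : C.Joint) (hQ : C.IsPillow Q) (a b : ZMod (C.size Q))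
    (hab : (K.layering Q).IsConeToCone a b)
    (hquad : ∃ t q, (E.simplex t).InPillow Q ∧ α t q = 0 ∧ S.quad t q ≠ 0) :
    (C.size Q = 4 ∨ C.size Q = 6) ∧ ((b = a + 1 ∨ a = b + 1) → C.size Q = 4) := by
  obtain ⟨t, q, htQ, -, hq0⟩ := hquad
  obtain ⟨m, hm⟩ : ∃ m, E.simplex t = .layer Q m := by
    generalize E.simplex t = σ at htQ
    rcases σ with _ | ⟨j, m⟩
    · exact htQ.elim
    · obtain rfl : j = Q := htQ
      exact ⟨m, rfl⟩
  have hn3 := C.three_le_size Q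
  have hne : a ≠ b := by
    intro h
    have := congrArg List.length hab.flips
    rw [if_pos h, List.length_ofFn] at this
    have := m.2
    simp_all
  obtain ⟨hlen, hq1, hq2⟩ := hab.quad_eq hne
  have hk0 := Polygon.val_sub_pos hne.symm
  have hkn := ZMod.val_lt (b - a)
  set k := (b - a).val with hk
  have hfact : Fact (1 < C.size Q) := ⟨by omega⟩
  have hk1 : b = a + 1 → k = 1 := by
    intro h
    rw [hk, h, add_sub_cancel_left, ZMod.val_one]
  have hk2 : a = b + 1 → k = C.size Q - 1 := by
    intro h
    have : b - a = -1 := by rw [h]; ring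
    rw [hk, this, ZMod.val_neg_of_ne_zero, ZMod.val_one]
  have hb0 : (K.layering Q).layer 0 = Polygon.cone a := hab.bottom
  have side : ∀ c : ZMod (C.size Q), c ≠ a → c ≠ b → (c = b + 1 ∨ b = c + 1) →
      ((K.layering Q).layer 0).IsNClique 3 {a, b, c} := by
    intro c hca hcb hc
    rw [hb0, SimpleGraph.is3Clique_triple_iff]
    simp only [Polygon.cone_adj]
    exact ⟨⟨hne, .inl trivial⟩, ⟨hca.symm, .inl trivial⟩, ⟨hcb.symm, .inr (.inr hc)⟩⟩
  have left : k ≠ 1 → _ := fun hk1' =>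
    PPPSubdivision.Triangulates.flips_dichotomy hα hS (Q := Q) (a := a) (b := b) 0 (k - 2)
      (by omega) (fun i => b - (i : ZMod (C.size Q)))
      (side _ (fun h => hk1' (by
          have : b - a = 1 := by
            rw [← h]
            push_cast
            ring
          rw [hk, this, ZMod.val_one]))
        (by simp) (.inr (by push_cast; ring)))
      (fun r hr h => by
        have := hq1 r hr (by omega)
        simp only [zero_add]
        exact this)
      (fun m hm => by
        have hm' := m.2
        obtain ⟨r, hr⟩ : ∃ r, (m : ℕ) = k - 2 + r := ⟨m - (k - 2), by omega⟩
        have e : m = ⟨k - 2 + r, hr ▸ m.2⟩ := Fin.ext hr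
        rw [e, hq2 r (by omega)]
        refine ⟨rfl, rfl, fun i h1 h2 => (Polygon.sub_natCast_ne_add_natCast b ?_ ?_).symm⟩ <;>
          omega)
  have right : k ≠ C.size Q - 1 → _ := fun hk2' =>
    PPPSubdivision.Triangulates.flips_dichotomy hα hS (Q := Q) (a := a) (b := b) (k - 2)
      (C.size Q - k - 2) (by omega) (fun i => b + (i : ZMod (C.size Q)))
      (side _ (fun h => hk2' (hk2 (by rw [← h]; push_cast; ring)))
        (by simp) (.inl (by push_cast; ring)))
      (fun r hr h => hq2 r hr h)
      (fun m hm => by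
        have hm' := m.2
        have hr : (m : ℕ) < k - 2 := by omega
        have := hq1 m hr m.2
        rw [this]
        refine ⟨rfl, rfl, fun i h1 h2 => Polygon.sub_natCast_ne_add_natCast b ?_ ?_⟩ <;>
          omega)
  have hmlt := m.2
  by_cases c1 : k = 1
  · obtain ⟨-, ⟨h, -⟩ | ⟨h, -⟩⟩ := right (by omega)
    · exact absurd (h m (by omega) (by omega) t (by
        rw [hm]; congr 1; exact Fin.ext (by simp; omega)) q) hq0
    · have : C.size Q = 4 := by omega
      exact ⟨.inl this, fun _ => this⟩
  by_cases c2 : k = C.size Q - 1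
  · obtain ⟨-, ⟨h, -⟩ | ⟨h, -⟩⟩ := left c1
    · exact absurd (h m (by omega) (by omega) t (by
        rw [hm]; congr 1; exact Fin.ext (by simp)) q) hq0
    · have : C.size Q = 4 := by omega
      exact ⟨.inl this, fun _ => this⟩
  obtain ⟨cl1, d1⟩ := left c1
  obtain ⟨cl2, d2⟩ := right c2
  have start : E.arc S (.layer Q 0 {a, b, b - ((1 : ℕ) : ZMod (C.size Q))} a) =
      E.arc S (.layer Q 0 {a, b, b + ((1 : ℕ) : ZMod (C.size Q))} a) := by
    obtain ⟨h1, h2, h3⟩ := SimpleGraph.is3Clique_triple_iff.1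
      (side (b - ((1 : ℕ) : ZMod (C.size Q))) (fun h => c1 (hk1 (by rw [← h]; push_cast; ring)))
        (by simp) (.inr (by push_cast; ring)))
    obtain ⟨-, h4, h5⟩ := SimpleGraph.is3Clique_triple_iff.1
      (side (b + ((1 : ℕ) : ZMod (C.size Q))) (fun h => c2 (hk2 (by rw [← h]; push_cast; ring)))
        (by simp) (.inl (by push_cast; ring)))
    rw [Set.pair_comm b]
    exact PPPSubdivision.Triangulates.arc_layer_endIndex_eq (s := false) hα hS h2 h1 h3.symm h4 h5
  have endEq : E.arc S (.layer Q (Fin.last _)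
        {a, b, b - ((k - 2 + 1 : ℕ) : ZMod (C.size Q))} a) =
      E.arc S (.layer Q (Fin.last _)
        {a, b, b + ((C.size Q - k - 2 + 1 : ℕ) : ZMod (C.size Q))} a) := by
    obtain ⟨h1, h2, h3⟩ := SimpleGraph.is3Clique_triple_iff.1 cl1
    obtain ⟨-, h4, h5⟩ := SimpleGraph.is3Clique_triple_iff.1 cl2
    rw [Set.pair_comm b]
    exact PPPSubdivision.Triangulates.arc_layer_endIndex_eq (s := true) hα hS h2 h1 h3.symm h4 h5
  have both : k - 2 = 1 → C.size Q - k - 2 = 1 →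
      (C.size Q = 4 ∨ C.size Q = 6) ∧ ((b = a + 1 ∨ a = b + 1) → C.size Q = 4) := by
    intro h1 h2
    refine ⟨.inr (by omega), ?_⟩
    rintro (h | h)
    · exact absurd (hk1 h) c1
    · exact absurd (hk2 h) c2
  rcases d1 with ⟨z1, s1⟩ | ⟨m1, s1⟩ <;> rcases d2 with ⟨z2, s2⟩ | ⟨m2, s2⟩
  · exfalso
    rcases Nat.lt_or_ge m (k - 2) with h | h
    · exact hq0 (z1 m h (by omega) t (by rw [hm]; congr 1; exact Fin.ext (by simp)) q)
    · exact hq0 (z2 (m - (k - 2)) (by omega) (by omega) t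
        (by rw [hm]; congr 1; exact Fin.ext (by simp; omega)) q)
  · exact absurd (endEq.symm.trans (s1.trans start)) s2
  · exact absurd (endEq.trans (s2.trans start.symm)) s1
  · exact both m1 m2
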